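/- **Setting.** Fix integers $m,n\ge 1$ and a real number $p>n$. Let $\mathcal M$ be the set of multi-indices $\alpha\in\mathbb Z_{\ge0}^n$ with $|\alpha|\le m-1$, and $\mathcal P$ the space of real polynomials on $\mathbb R^n$ of degree at most $m-1$. For distinct multi-indices write $\alpha<\beta$ if $\sum_{i\le k}\alpha_i<\sum_{i\le k}\beta_i$ for the largest $k\in\{0,\dots,n\}$ at which these two partial sums differ. For distinct $\mathcal A',\mathcal A\subset\mathcal M$ write $\mathcal A'<\mathcal A$ if the minimal element of $\mathcal A'\,\Delta\,\mathcal A$ lies in $\mathcal A'$. Let $L^{m,p}(\mathbb R^n)$ be the homogeneous Sobolev space with seminorm $\|F\|=\max_{|\alpha|=m}\|\partial^\alpha F\|_{L^p(\mathbb R^n)}$ (distributional derivatives), its elements being taken as $C^{m-1}$ functions, and let $J_xF\in\mathcal P$ be the Taylor polynomial of $F$ at $x$ of degree $m-1$. For $x\in\mathbb R^n$ and $E\subset\mathbb R^n$ put $$\sigma(x,E)=\{J_x\varphi:\ \varphi\in L^{m,p}(\mathbb R^n),\ \varphi|_E=0,\ \|\varphi\|\le1\}.$$ For $\epsilon,\delta>0$,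 an $(\mathcal A,x,\epsilon,\delta)$-basis for $\sigma\subset\mathcal P$ is a family $(P_\alpha)_{\alpha\in\mathcal A}$ in $\mathcal P$ such that $P_\alpha\in\epsilon\,\delta^{n/p+|\alpha|-m}\sigma$ for $\alpha\in\mathcal A$; $\partial^\beta P_\alpha(x)=\delta_{\alpha\beta}$ for $\alpha,\beta\in\mathcal A$; and $|\partial^\beta P_\alpha(x)|\le\epsilon\,\delta^{|\alpha|-|\beta|}$ for $\alpha\in\mathcal A$, $\beta\in\mathcal M$, $\beta>\alpha$. A dyadic cube is a set $Q=\prod_{i=1}^n(j_i2^k,(j_i+1)2^k]$ with $j_i,k\in\mathbb Z$; its sidelength is $\delta_Q=2^k$, and for $A>0$, $AQ$ is the (half-open) cube with the same center and sidelength $A\delta_Q$. Let $Q^\circ=(0,1]^n$. Let $\mathcal A\subsetneq\mathcal M$, $\epsilon_0>0$, and let $E\subset\frac18Q^\circ$ be a finite set with $N=\#(E)\ge2$, such that for every $\mathcal A'<\mathcal A$ there is $x\in E$ for which $\sigma(x,E)$ does not contain an $(\mathcal A',x,\epsilon_0,1)$-basis. A dyadic cube $Q\subset Q^\circ$ is OK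 if either $\#(E\cap3Q)\le1$, or there is $\mathcal A'<\mathcal A$ such that $\sigma(x,E\cap3Q)$ contains an $(\mathcal A',x,\epsilon_0,30\delta_Q)$-basis for every $x\in E\cap3Q$. Let $CZ^\circ$ be the collection of the OK dyadic cubes $Q\subset Q^\circ$ such that no dyadic cube $Q'$ with $Q\subsetneq Q'\subset Q^\circ$ is OK. For $Q,Q'\in CZ^\circ$ write $Q\leftrightarrow Q'$ if $\mathrm{cl}(Q)\cap\mathrm{cl}(Q')\ne\emptyset$. A cube $Q\in CZ^\circ$ is a keystone cube if $\delta_{Q'}\ge\delta_Q$ for every $Q'\in CZ^\circ$ that meets $100Q$. **Proposition.** There are constants $C>0$ and $c\in(0,1)$, depending only on $m,n,p$, such that for all $\mathcal A,\epsilon_0,E$ as above the collection $CZ^\circ=\{Q_1,\dots,Q_{\nu_{\max}}\}$ is finite, and to each $Q_\nu\in CZ^\circ$ one can assign a finite sequence $\mathcal S_\nu=(Q_{\nu,1},\dots,Q_{\nu,L_\nu})$ (with $L_\nu\ge1$) of cubes from $CZ^\circ$ such that: * **(K1)** $Q_{\nu,1}=Q_\nu$ and $Q_{\nu,L_\nu}$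 is a keystone cube; $Q_{\nu,l}\leftrightarrow Q_{\nu,l+1}$ for $1\le l\le L_\nu-1$; and $\delta_{Q_{\nu,k}}\le C(1-c)^{k-l}\delta_{Q_{\nu,l}}$ for $1\le l\le k\le L_\nu$. * **(K2)** With $\mathcal K(Q_\nu)=Q_{\nu,L_\nu}$, $$\#\{(\nu,\nu')\in\{1,\dots,\nu_{\max}\}^2:\ Q_\nu\leftrightarrow Q_{\nu'}\ \text{and}\ \mathcal K(Q_\nu)\ne\mathcal K(Q_{\nu'})\}\le C\,N.$$ * **(K3)** $\mathcal K(Q_\nu)=Q_\nu$ for every keystone cube $Q_\nu$. -/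

import Mathlib

open MeasureTheory
open scoped Pointwise ContDiff

noncomputable section

namespace SobolevExt

/-! ### Multi-indices and labels -/

/-- The order `|α| = α₁ + ⋯ + αₙ` of a multi-index. -/
def miOrder {n : ℕ} (α : Fin n → ℕ) : ℕ := ∑ i, α i

/-- The set `𝓜` of the multi-indices of order at most `m - 1` (for `m ≥ 1`). -/
def multiIndices (n m : ℕ) : Finset (Fin n → ℕ) :=
  (Fintype.piFinset fun _ => Finset.range m).filter fun α => miOrder α < m

/-- The partial sum `α₁ + ⋯ + αₖ`. -/
def partialSum {n : ℕ} (α : Fin n → ℕ) (k : ℕ) : ℕ :=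
  ∑ i ∈ Finset.univ.filter (fun i : Fin n => i.val < k), α i

/-- The order on multi-indices: `α < β` if, for the largest `k ∈ {0, …, n}` at which the `k`-th
partial sums of `α` and `β` differ, that of `α` is the smaller one. -/
def MultiIndexLT {n : ℕ} (α β : Fin n → ℕ) : Prop :=
  ∃ k ≤ n, (∀ j, k < j → j ≤ n → partialSum α j = partialSum β j) ∧
    partialSum α k < partialSum β k

/-- The order on labels (sets of multi-indices): `𝒜 < ℬ` if the minimal element of the symmetric
difference of `𝒜` and `ℬ` lies in `𝒜`. -/
def LabelLT {n : ℕ} (𝒜 ℬ : Finset (Fin n → ℕ)) : Prop :=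
  ∃ α ∈ symmDiff 𝒜 ℬ, α ∈ 𝒜 ∧ ∀ β ∈ symmDiff 𝒜 ℬ, β ≠ α → MultiIndexLT α β

/-! ### Derivatives, jets, and the homogeneous Sobolev space

Functions are defined on `Fin n → ℝ`, which carries the maximum norm and Lebesgue measure. -/

/-- The partial derivative `∂ᵢ f`. -/
def pd {n : ℕ} (i : Fin n) (f : (Fin n → ℝ) → ℝ) : (Fin n → ℝ) → ℝ :=
  fun x => fderiv ℝ f x (Pi.single i 1)

/-- The iterated partial derivative `∂₁^{α₁} ⋯ ∂ₙ^{αₙ} f`; it is used for functions that are at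
least `|α|` times continuously differentiable. -/
def pderivs {n : ℕ} (α : Fin n → ℕ) (f : (Fin n → ℝ) → ℝ) : (Fin n → ℝ) → ℝ :=
  (List.finRange n).foldr (fun i g => (pd i)^[α i] g) f

/-- The jet `J_y F`: the Taylor polynomial of `F` at `y` of degree `m - 1`. -/
def jet {n : ℕ} (m : ℕ) (F : (Fin n → ℝ) → ℝ) (y : Fin n → ℝ) : MvPolynomial (Fin n) ℝ :=
  ∑ α ∈ multiIndices n m,
    MvPolynomial.C (pderivs α F y / ((∏ i, (α i).factorial : ℕ) : ℝ)) *
      ∏ i, (MvPolynomial.X i - MvPolynomial.C (y i)) ^ α i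

/-- `g` is the distributional derivative `∂^α F` on `ℝⁿ`. -/
def HasWeakDeriv {n : ℕ} (α : Fin n → ℕ) (F g : (Fin n → ℝ) → ℝ) : Prop :=
  LocallyIntegrable F volume ∧ LocallyIntegrable g volume ∧
    ∀ θ : (Fin n → ℝ) → ℝ, ContDiff ℝ ∞ θ → HasCompactSupport θ →
      ∫ x, F x * pderivs α θ x = (-1) ^ miOrder α * ∫ x, g x * θ x

/-- The seminorm `‖F‖_{L^{m,p}(ℝⁿ)}`, the maximum over `|α| = m` of the `L^p` norm of the weak
derivative `∂^α F`. The weak derivative is unique up to null sets, so that the infimum is over a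
single value; it is `∞` if there is no weak derivative. -/
def sobolevSeminorm {n : ℕ} (m : ℕ) (p : ℝ) (F : (Fin n → ℝ) → ℝ) : ENNReal :=
  ⨆ (α : Fin n → ℕ) (_ : miOrder α = m),
    ⨅ (g : (Fin n → ℝ) → ℝ) (_ : HasWeakDeriv α F g), eLpNorm g (ENNReal.ofReal p) volume

/-- Membership in `L^{m,p}(ℝⁿ)` for `p > n`, each class being represented by its unique member
in `C^{m-1}`. -/
def MemSobolev {n : ℕ} (m : ℕ) (p : ℝ) (F : (Fin n → ℝ) → ℝ) : Prop :=
  ContDiff ℝ ((m - 1 : ℕ) : WithTop ℕ∞) F ∧ sobolevSeminorm m p F < ⊤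

/-- `σ(x, E)`: the jets at `x` of the functions in `L^{m,p}(ℝⁿ)` of seminorm at most one that
vanish on `E`. -/
def sigma {n : ℕ} (m : ℕ) (p : ℝ) (x : Fin n → ℝ) (E : Set (Fin n → ℝ)) :
    Set (MvPolynomial (Fin n) ℝ) :=
  {P | ∃ φ : (Fin n → ℝ) → ℝ, MemSobolev m p φ ∧ jet m φ x = P ∧ (∀ y ∈ E, φ y = 0) ∧
    sobolevSeminorm m p φ ≤ 1}

/-- The number `∂^β P(x)`. -/
def polyDeriv {n : ℕ} (β : Fin n → ℕ) (P : MvPolynomial (Fin n) ℝ) (x : Fin n → ℝ) : ℝ :=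
  pderivs β (fun y => MvPolynomial.eval y P) x

/-- `(P_α)_{α ∈ 𝒜}` forms an `(𝒜, x, ε, δ)`-basis for the set `σ` of polynomials. -/
def IsLabeledBasis {n : ℕ} (m : ℕ) (p : ℝ) (𝒜 : Finset (Fin n → ℕ)) (x : Fin n → ℝ) (ε δ : ℝ)
    (σ : Set (MvPolynomial (Fin n) ℝ)) (P : (Fin n → ℕ) → MvPolynomial (Fin n) ℝ) : Prop :=
  (∀ α ∈ 𝒜, P α ∈ (ε * δ ^ ((n : ℝ) / p + (miOrder α : ℝ) - (m : ℝ))) • σ) ∧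
  (∀ α ∈ 𝒜, ∀ β ∈ 𝒜, polyDeriv β (P α) x = if α = β then 1 else 0) ∧
  (∀ α ∈ 𝒜, ∀ β ∈ multiIndices n m, MultiIndexLT α β →
    |polyDeriv β (P α) x| ≤ ε * δ ^ ((miOrder α : ℝ) - (miOrder β : ℝ)))

/-- The set `σ` of polynomials contains an `(𝒜, x, ε, δ)`-basis. -/
def ContainsBasis {n : ℕ} (m : ℕ) (p : ℝ) (𝒜 : Finset (Fin n → ℕ)) (x : Fin n → ℝ) (ε δ : ℝ)
    (σ : Set (MvPolynomial (Fin n) ℝ)) : Prop :=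
  ∃ P : (Fin n → ℕ) → MvPolynomial (Fin n) ℝ, IsLabeledBasis m p 𝒜 x ε δ σ P

/-! ### Dyadic cubes -/

/-- The dyadic cube `∏ᵢ (jᵢ 2ᵏ, (jᵢ + 1) 2ᵏ]`, given by `k` and `j`
(which it determines when `n ≥ 1`). -/
@[ext] structure DyadicCube (n : ℕ) where
  /-- The exponent of the sidelength. -/
  k : ℤ
  /-- The position. -/
  j : Fin n → ℤ

namespace DyadicCube

variable {n : ℕ}

/-- The sidelength `δ_Q`. -/
def side (Q : DyadicCube n) : ℝ := (2 : ℝ) ^ Q.k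

/-- The cube as a set of points. -/
def toSet (Q : DyadicCube n) : Set (Fin n → ℝ) :=
  {x | ∀ i, (Q.j i : ℝ) * 2 ^ Q.k < x i ∧ x i ≤ ((Q.j i : ℝ) + 1) * 2 ^ Q.k}

/-- The center. -/
def center (Q : DyadicCube n) : Fin n → ℝ := fun i => ((Q.j i : ℝ) + 1 / 2) * 2 ^ Q.k

/-- The cube `A Q` with the same center as `Q` and sidelength `A δ_Q`, as a set of points. -/
def dilate (A : ℝ) (Q : DyadicCube n) : Set (Fin n → ℝ) :=
  {x | ∀ i, Q.center i - A * Q.side / 2 < x i ∧ x i ≤ Q.center i + A * Q.side / 2}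

/-- The unit cube `Q° = (0, 1]ⁿ`. -/
def unit (n : ℕ) : DyadicCube n := ⟨0, fun _ => 0⟩

/-- `Q` and `Q'` are neighbors, `Q ↔ Q'`: their closures meet. -/
def Neighbor (Q Q' : DyadicCube n) : Prop := (closure Q.toSet ∩ closure Q'.toSet).Nonempty

end DyadicCube

/-! ### The Calderón–Zygmund decomposition of the unit cube -/

/-- The dyadic cube `Q` is OK (relative to the label `𝒜`, the number `ε₀` and the set `E`). -/
def IsOK {n : ℕ} (m : ℕ) (p : ℝ) (𝒜 : Finset (Fin n → ℕ)) (ε₀ : ℝ) (E : Finset (Fin n → ℝ))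
    (Q : DyadicCube n) : Prop :=
  ((E : Set (Fin n → ℝ)) ∩ Q.dilate 3).ncard ≤ 1 ∨
  ∃ 𝒜' : Finset (Fin n → ℕ), 𝒜' ⊆ multiIndices n m ∧ LabelLT 𝒜' 𝒜 ∧
    ∀ x ∈ (E : Set (Fin n → ℝ)) ∩ Q.dilate 3,
      ContainsBasis m p 𝒜' x ε₀ (30 * Q.side) (sigma m p x ((E : Set (Fin n → ℝ)) ∩ Q.dilate 3))

/-- The collection `CZ°` of Calderón–Zygmund cubes: the maximal OK dyadic subcubes of `Q°`. -/
def CZ {n : ℕ} (m : ℕ) (p : ℝ) (𝒜 : Finset (Fin n → ℕ)) (ε₀ : ℝ) (E : Finset (Fin n → ℝ)) :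
    Set (DyadicCube n) :=
  {Q | Q.toSet ⊆ (DyadicCube.unit n).toSet ∧ IsOK m p 𝒜 ε₀ E Q ∧
    ∀ Q' : DyadicCube n, Q'.toSet ⊆ (DyadicCube.unit n).toSet → Q.toSet ⊂ Q'.toSet →
      ¬ IsOK m p 𝒜 ε₀ E Q'}

/-- The keystone cubes of a collection `𝒞` of dyadic cubes: those `Q ∈ 𝒞` such that every
`Q' ∈ 𝒞` that meets `100 Q` is at least as large as `Q`. -/
def keystone {n : ℕ} (𝒞 : Set (DyadicCube n)) : Set (DyadicCube n) :=
  {Q | Q ∈ 𝒞 ∧ ∀ Q' ∈ 𝒞, (Q'.toSet ∩ Q.dilate 100).Nonempty → Q.side ≤ Q'.side}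

end SobolevExt

end

open SobolevExt

/-!
The statement is purely geometric: what the Sobolev space contributes is that a cube is OK as soon
as its triple lies in the triple of a larger OK cube. Hence the sidelengths in `CZ°` vary slowly,
and the parent of each cube of `CZ°`, not being OK, has two points of `E` in its triple.

All but `O(#E)` of the cubes `Q` of `CZ°` are interstitial: the part of `E` near `Q` is one tight
cluster, much smaller than `Q`, at which there are much smaller cubes of `CZ°`. The others are
counted by a packing argument, taking the points of `E` farthest-first. From an interstitial cube,
descend along the ray to a point of the cluster, the pole, until the sphere about the pole at the
scale of the cluster is reached, and go on to a cube chosen once for each connected component of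
the cubes meeting that sphere. The radial projections of two touching cubes overlap, so neighboring
interstitial cubes end at the same cube. From there short walks, each at least halving the
sidelength, lead to a keystone cube. Hence only pairs involving a cube that is not interstitial can
have different keystone cubes.
-/

noncomputable section

namespace SobolevExt

variable {n : ℕ}

/-! ### Dyadic cubes -/

namespace DyadicCube

variable {Q Q' : DyadicCube n} {x : Fin n → ℝ} {A A' : ℝ}

instance : Nonempty (DyadicCube n) := ⟨unit n⟩

lemma side_pos (Q : DyadicCube n) : 0 < Q.side := zpow_pos two_pos _

lemma side_unit (n : ℕ) : (unit n).side = 1 := zpow_zero 2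

lemma side_le_side_iff : Q.side ≤ Q'.side ↔ Q.k ≤ Q'.k :=
  zpow_le_zpow_iff_right₀ one_lt_two

lemma side_lt_side_iff : Q.side < Q'.side ↔ Q.k < Q'.k :=
  zpow_lt_zpow_iff_right₀ one_lt_two

lemma two_mul_side (Q : DyadicCube n) : 2 * Q.side = 2 ^ (Q.k + 1) :=
  (zpow_one_add₀ two_ne_zero Q.k).symm.trans (by rw [add_comm])

lemma side_le_half_of_lt (h : Q.side < Q'.side) : Q.side ≤ Q'.side / 2 := by
  have : 2 * Q.side ≤ Q'.side :=
    Q.two_mul_side.trans_le (zpow_le_zpow_right₀ one_le_two (side_lt_side_iff.1 h))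
  linarith

lemma side_le_two_mul_of_lt (h : Q'.side < 4 * Q.side) : Q'.side ≤ 2 * Q.side := by
  by_contra! hlt
  have hk := Q.two_mul_side ▸ hlt
  have : (2 : ℝ) ^ (Q.k + 2) ≤ Q'.side :=
    zpow_le_zpow_right₀ one_le_two (by linarith [(zpow_lt_zpow_iff_right₀ one_lt_two).1 hk])
  rw [zpow_add₀ two_ne_zero] at this
  exact absurd (this.trans_lt h) (by norm_num [side, mul_comm])

lemma toSet_eq_dilate_one (Q : DyadicCube n) : Q.toSet = Q.dilate 1 := by
  ext x
  refine forall_congr' fun i => ?_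
  simp only [center, side]
  ring_nf

lemma dilate_eq_pi (A : ℝ) (Q : DyadicCube n) : Q.dilate A = Set.univ.pi fun i =>
    Set.Ioc (Q.center i - A * Q.side / 2) (Q.center i + A * Q.side / 2) := by
  ext x
  simp [dilate]

lemma norm_sub_center_le_of_mem_dilate (hA : 0 ≤ A) (hx : x ∈ Q.dilate A) :
    ‖x - Q.center‖ ≤ A * Q.side / 2 := by
  have := Q.side_pos
  refine (pi_norm_le_iff_of_nonneg (by positivity)).2 fun i => ?_
  rw [Real.norm_eq_abs, abs_le, Pi.sub_apply]
  constructor <;> linarith [(hx i).1, (hx i).2]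

lemma mem_dilate_of_norm_lt (hx : ‖x - Q.center‖ < A * Q.side / 2) : x ∈ Q.dilate A := by
  intro i
  have := (norm_le_pi_norm _ i).trans_lt hx
  rw [Real.norm_eq_abs, abs_lt, Pi.sub_apply] at this
  constructor <;> linarith [this.1, this.2]

lemma norm_sub_center_le_of_mem_closure (hx : x ∈ closure Q.toSet) :
    ‖x - Q.center‖ ≤ Q.side / 2 := by
  have hball : Q.toSet ⊆ Metric.closedBall Q.center (Q.side / 2) := fun y hy => by
    rw [toSet_eq_dilate_one] at hy
    simpa [dist_eq_norm] using norm_sub_center_le_of_mem_dilate zero_le_one hy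
  exact mem_closedBall_iff_norm.1 (closure_minimal hball Metric.isClosed_closedBall hx)

lemma norm_sub_center_le_of_mem (hx : x ∈ Q.toSet) : ‖x - Q.center‖ ≤ Q.side / 2 :=
  norm_sub_center_le_of_mem_closure (subset_closure hx)

lemma mem_of_norm_sub_center_lt (hx : ‖x - Q.center‖ < Q.side / 2) : x ∈ Q.toSet := by
  rw [toSet_eq_dilate_one]
  exact mem_dilate_of_norm_lt (by rwa [one_mul])

lemma center_mem (Q : DyadicCube n) : Q.center ∈ Q.toSet :=
  mem_of_norm_sub_center_lt (by simpa using Q.side_pos)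

lemma convex_toSet (Q : DyadicCube n) : Convex ℝ Q.toSet := by
  rw [toSet_eq_dilate_one, dilate_eq_pi]
  exact convex_pi fun i _ => convex_Ioc _ _

lemma isPreconnected_closure (Q : DyadicCube n) : IsPreconnected (closure Q.toSet) :=
  Q.convex_toSet.isPreconnected.closure

lemma Neighbor.refl (Q : DyadicCube n) : Q.Neighbor Q :=
  ⟨Q.center, subset_closure Q.center_mem, subset_closure Q.center_mem⟩

lemma Neighbor.symm (h : Q.Neighbor Q') : Q'.Neighbor Q := by
  rwa [Neighbor, Set.inter_comm]

lemma Neighbor.norm_center_sub_le (h : Q.Neighbor Q') :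
    ‖Q.center - Q'.center‖ ≤ (Q.side + Q'.side) / 2 := by
  obtain ⟨y, hy, hy'⟩ := h
  have hyQ := norm_sub_center_le_of_mem_closure hy
  rw [norm_sub_rev] at hyQ
  linarith [norm_sub_center_le_of_mem_closure hy',
    norm_sub_le_norm_sub_add_norm_sub Q.center y Q'.center]

lemma dilate_subset_dilate
    (h : ‖Q.center - Q'.center‖ ≤ (A' * Q'.side - A * Q.side) / 2) :
    Q.dilate A ⊆ Q'.dilate A' := by
  intro x hx i
  have := (norm_le_pi_norm _ i).trans h
  rw [Real.norm_eq_abs, abs_le, Pi.sub_apply] at this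
  constructor <;> linarith [(hx i).1, (hx i).2, this.1, this.2]

lemma abs_center_sub_le_of_toSet_subset (h : Q.toSet ⊆ Q'.toSet) (i : Fin n) :
    |Q.center i - Q'.center i| ≤ (Q'.side - Q.side) / 2 := by
  have hne : ∀ i, Q.center i - 1 * Q.side / 2 < Q.center i + 1 * Q.side / 2 := fun i => by
    linarith [Q.side_pos]
  simp only [toSet_eq_dilate_one, dilate_eq_pi] at h
  rcases Set.univ_pi_subset_univ_pi_iff.1 h with hsub | ⟨j, hempty⟩
  · obtain ⟨hupper, hlower⟩ := (Set.Ioc_subset_Ioc_iff (hne i)).1 (hsub i)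
    rw [abs_le]
    constructor <;> linarith
  · exact absurd hempty (Set.nonempty_Ioc.2 (hne j)).ne_empty

lemma side_le_of_toSet_subset (hn : 1 ≤ n) (h : Q.toSet ⊆ Q'.toSet) : Q.side ≤ Q'.side := by
  linarith [(abs_nonneg _).trans (abs_center_sub_le_of_toSet_subset h ⟨0, hn⟩)]

/-- The dyadic cube of sidelength `2 ^ k` that contains `y`. -/
def around (y : Fin n → ℝ) (k : ℤ) : DyadicCube n := ⟨k, fun i => ⌈y i / 2 ^ k⌉ - 1⟩

lemma mem_toSet_iff_ceil : x ∈ Q.toSet ↔ ∀ i, ⌈x i / 2 ^ Q.k⌉ = Q.j i + 1 := by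
  have hpos : (0 : ℝ) < 2 ^ Q.k := zpow_pos two_pos _
  refine forall_congr' fun i => ?_
  rw [Int.ceil_eq_iff, lt_div_iff₀ hpos, div_le_iff₀ hpos]
  push_cast
  rw [add_sub_cancel_right]

lemma mem_toSet_iff_eq_around : x ∈ Q.toSet ↔ Q = around x Q.k := by
  simp only [mem_toSet_iff_ceil, around, DyadicCube.ext_iff, funext_iff, true_and,
    eq_sub_iff_add_eq, eq_comm (b := Q.j _ + 1)]

lemma mem_toSet_around (y : Fin n → ℝ) (k : ℤ) : y ∈ (around y k).toSet :=
  mem_toSet_iff_eq_around.2 rfl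

lemma toSet_subset_of_k_le (hk : Q.k ≤ Q'.k) (hx : x ∈ Q.toSet) (hx' : x ∈ Q'.toSet) :
    Q.toSet ⊆ Q'.toSet := by
  obtain ⟨d, hd⟩ := Int.le.dest hk
  have hscale : (2 : ℝ) ^ Q'.k = 2 ^ d * 2 ^ Q.k := by
    rw [← hd, zpow_add₀ two_ne_zero, zpow_natCast, mul_comm]
  have hpos : (0 : ℝ) < 2 ^ Q.k := zpow_pos two_pos _
  have ceil_le_iff (a : ℝ) (c : ℤ) : ⌈a / 2 ^ Q'.k⌉ ≤ c ↔ ⌈a / 2 ^ Q.k⌉ ≤ c * 2 ^ d := by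
    rw [Int.ceil_le, Int.ceil_le, div_le_iff₀ (by positivity), div_le_iff₀ hpos, hscale]
    push_cast
    rw [mul_assoc]
  intro y hy
  rw [mem_toSet_iff_ceil] at hx hy hx' ⊢
  intro i
  rw [← hx' i]
  refine eq_of_forall_ge_iff fun c => ?_
  rw [ceil_le_iff, ceil_le_iff, hx i, hy i]

/-- The dyadic cube of twice the sidelength that contains `Q`. -/
def parent (Q : DyadicCube n) : DyadicCube n := around Q.center (Q.k + 1)

lemma side_parent (Q : DyadicCube n) : Q.parent.side = 2 * Q.side := Q.two_mul_side.symm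

lemma toSet_subset_parent (Q : DyadicCube n) : Q.toSet ⊆ Q.parent.toSet :=
  toSet_subset_of_k_le (Int.le_add_one le_rfl) Q.center_mem (mem_toSet_around _ _)

lemma toSet_ssubset_parent (hn : 1 ≤ n) (Q : DyadicCube n) : Q.toSet ⊂ Q.parent.toSet := by
  refine ⟨Q.toSet_subset_parent, fun h => ?_⟩
  have := side_le_of_toSet_subset hn h
  linarith [Q.side_parent, Q.side_pos]

lemma norm_parent_center_sub_le (Q : DyadicCube n) :
    ‖Q.parent.center - Q.center‖ ≤ Q.side / 2 := by
  have := Q.side_pos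
  refine (pi_norm_le_iff_of_nonneg (by positivity)).2 fun i => ?_
  have := abs_center_sub_le_of_toSet_subset Q.toSet_subset_parent i
  rw [Pi.sub_apply, Real.norm_eq_abs, abs_sub_comm]
  linarith [Q.side_parent]

lemma eq_unit_or_parent_subset (hn : 1 ≤ n) (h : Q.toSet ⊆ (unit n).toSet) :
    Q = unit n ∨ Q.side ≤ 1 / 2 ∧ Q.parent.toSet ⊆ (unit n).toSet := by
  have hcenter := h Q.center_mem
  have hk : Q.k ≤ 0 := side_le_side_iff.1 (side_le_of_toSet_subset hn h)
  rcases hk.eq_or_lt with hk | hk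
  · left
    exact (mem_toSet_iff_eq_around.1 Q.center_mem).trans
      (hk ▸ (mem_toSet_iff_eq_around.1 hcenter).symm)
  · right
    have hside := side_le_half_of_lt (side_lt_side_iff.2 (show Q.k < (unit n).k from hk))
    rw [side_unit] at hside
    exact ⟨hside, toSet_subset_of_k_le (Q' := unit n) hk (mem_toSet_around _ _) hcenter⟩

end DyadicCube

/-! ### Packing -/

section Packing

/-- The dyadic cubes whose sidelength lies between `a` and `K * a` and whose center lies within
`K * a` of `z`. -/
def nearScale (K a : ℝ) (z : Fin n → ℝ) : Set (DyadicCube n) :=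
  {Q | a ≤ Q.side ∧ Q.side ≤ K * a ∧ ‖Q.center - z‖ ≤ K * a}

/-- A bound for the number of cubes in `nearScale K a z` that depends only on `n` and `K`. -/
def packingBound (n : ℕ) (K : ℝ) : ℕ := (2 * ⌈K⌉₊ + 5) ^ (n + 1)

/-- The exponent and the position of a dyadic cube, measured from the scale `a` and the
point `z`. -/
def relativePosition (a : ℝ) (z : Fin n → ℝ) (Q : DyadicCube n) : Fin (n + 1) → ℤ :=
  Fin.cons (Q.k - Int.log 2 a) fun i => Q.j i - ⌊z i / 2 ^ Q.k⌋

variable {K a : ℝ} {z : Fin n → ℝ} {Q : DyadicCube n}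

lemma relativePosition_injective (a : ℝ) (z : Fin n → ℝ) :
    Function.Injective (relativePosition a z) := by
  intro Q Q' h
  obtain ⟨hk, hj⟩ := Fin.cons_injective2 h
  have hk : Q.k = Q'.k := sub_left_injective hk
  ext i
  · exact hk
  · have := congrFun hj i
    rw [hk] at this
    exact sub_left_injective this

lemma abs_k_sub_log_le (ha : 0 < a) (hQ : Q ∈ nearScale K a z) :
    |Q.k - Int.log 2 a| ≤ ⌈K⌉₊ + 2 := by
  have hlower : (2 : ℝ) ^ Int.log 2 a ≤ 2 ^ Q.k :=
    (Int.zpow_log_le_self one_lt_two ha).trans hQ.1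
  have hupper : (2 : ℝ) ^ Q.k < 2 ^ ((⌈K⌉₊ : ℤ) + (Int.log 2 a + 1)) := by
    rw [zpow_add₀ two_ne_zero, zpow_natCast]
    have hK : K ≤ 2 ^ ⌈K⌉₊ := (Nat.le_ceil K).trans (by exact_mod_cast Nat.lt_two_pow_self.le)
    calc (2 : ℝ) ^ Q.k ≤ K * a := hQ.2.1
      _ ≤ 2 ^ ⌈K⌉₊ * a := by gcongr
      _ < _ := by gcongr; exact_mod_cast Int.lt_zpow_succ_log_self one_lt_two a
  have := (zpow_le_zpow_iff_right₀ (one_lt_two (α := ℝ))).1 hlower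
  have := (zpow_lt_zpow_iff_right₀ (one_lt_two (α := ℝ))).1 hupper
  rw [abs_le]
  constructor <;> linarith

lemma abs_j_sub_floor_le (ha : 0 < a) (hQ : Q ∈ nearScale K a z) (i : Fin n) :
    |Q.j i - ⌊z i / 2 ^ Q.k⌋| ≤ ⌈K⌉₊ + 2 := by
  have hpos : (0 : ℝ) < 2 ^ Q.k := zpow_pos two_pos _
  have hcoord : |(Q.j i : ℝ) + 1 / 2 - z i / 2 ^ Q.k| ≤ ⌈K⌉₊ := by
    refine le_of_mul_le_mul_right ?_ hpos
    calc |(Q.j i : ℝ) + 1 / 2 - z i / 2 ^ Q.k| * 2 ^ Q.k = |(Q.center - z) i| := by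
          rw [← abs_of_pos hpos, ← abs_mul, abs_of_pos hpos, sub_mul, div_mul_cancel₀ _ hpos.ne']
          rfl
      _ ≤ K * a := (norm_le_pi_norm (Q.center - z) i).trans hQ.2.2
      _ ≤ ⌈K⌉₊ * 2 ^ Q.k := mul_le_mul (Nat.le_ceil K) hQ.1 ha.le (Nat.cast_nonneg _)
  have hfloor := Int.floor_le (z i / 2 ^ Q.k)
  have hfloor' := Int.lt_floor_add_one (z i / 2 ^ Q.k)
  rw [abs_le] at hcoord
  have : |(Q.j i : ℝ) - ⌊z i / 2 ^ Q.k⌋| ≤ ⌈K⌉₊ + 2 := by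
    rw [abs_le]
    constructor <;> linarith
  exact_mod_cast this

lemma encard_nearScale_le (ha : 0 < a) (z : Fin n → ℝ) :
    (nearScale K a z).encard ≤ packingBound n K := by
  let T : Finset (Fin (n + 1) → ℤ) :=
    Fintype.piFinset fun _ => Finset.Icc (-(⌈K⌉₊ + 2 : ℤ)) (⌈K⌉₊ + 2)
  have hmaps : Set.MapsTo (relativePosition a z) (nearScale K a z) T := by
    intro Q hQ
    refine Finset.mem_coe.2 (Fintype.mem_piFinset.2 fun i => Finset.mem_Icc.2 (abs_le.1 ?_))
    refine Fin.cases ?_ (fun i => ?_) i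
    · exact abs_k_sub_log_le ha hQ
    · exact abs_j_sub_floor_le ha hQ i
  have hcard : T.card = packingBound n K := by
    simp only [T, Fintype.card_piFinset_const, Int.card_Icc, packingBound]
    congr 1
    omega
  rw [← hcard, ← Set.encard_coe_eq_coe_finsetCard]
  exact Set.encard_le_encard_of_injOn hmaps (relativePosition_injective a z).injOn

lemma encard_le_of_forall_exists_nearScale {S : Set (DyadicCube n)} {E : Finset (Fin n → ℝ)}
    {a : (Fin n → ℝ) → ℝ} (h : ∀ Q ∈ S, ∃ z ∈ E, 0 < a z ∧ Q ∈ nearScale K (a z) z) :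
    S.encard ≤ (E.card * packingBound n K : ℕ) := by
  have hsub : S ⊆ ⋃ z ∈ E.filter (0 < a ·), nearScale K (a z) z := fun Q hQ => by
    obtain ⟨z, hz, ha, hQz⟩ := h Q hQ
    exact Set.mem_biUnion (Finset.mem_coe.2 (Finset.mem_filter.2 ⟨hz, ha⟩)) hQz
  calc S.encard ≤ (⋃ z ∈ E.filter (0 < a ·), nearScale K (a z) z).encard :=
        Set.encard_le_encard hsub
    _ ≤ ∑ z ∈ E.filter (0 < a ·), (nearScale K (a z) z).encard :=
        Finset.set_encard_biUnion_le _ _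
    _ ≤ (E.filter (0 < a ·)).card • (packingBound n K : ℕ∞) :=
        Finset.sum_le_card_nsmul _ _ _ fun z hz =>
          encard_nearScale_le (Finset.mem_filter.1 hz).2 z
    _ ≤ (E.card * packingBound n K : ℕ) := by
        rw [nsmul_eq_mul]
        exact_mod_cast Nat.mul_le_mul_right _ (Finset.card_filter_le _ _)

end Packing

/-! ### Nets of a finite metric space -/

section Nets

variable {X : Type*} [MetricSpace X] {E P : Finset X} {S D : ℝ} {r : X → ℝ}

/-- The state of a farthest-point ordering of `E`: the points of `P` have been chosen with weights
`r`, each weight being the distance of the point to its predecessors, `D` is the last of these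
distances, and weights are unconstrained beyond the threshold `S`. -/
structure IsPartialNet (E P : Finset X) (S : ℝ) (r : X → ℝ) (D : ℝ) : Prop where
  subset : P ⊆ E
  nonempty : P.Nonempty
  separated : ∀ x ∈ P, ∀ y ∈ P, x ≠ y → min (r x) (r y) ≤ dist x y
  le_weight : ∀ z ∈ P, D ≤ r z
  dense : ∀ x ∈ E, ∃ z ∈ P, dist x z ≤ D
  dense_of_le : ∀ s, D ≤ s → s < S → ∀ x ∈ E, ∃ z ∈ P, s < r z ∧ dist x z ≤ s

lemma exists_isPartialNet_singleton {x₀ : X} (hx₀ : x₀ ∈ E) (S : ℝ) :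
    ∃ r D, IsPartialNet E {x₀} S r D := by
  refine ⟨fun _ => max S (∑ x ∈ E, dist x x₀), max S (∑ x ∈ E, dist x x₀),
    by simpa using hx₀, by simp, by simp, by simp, fun x hx => ⟨x₀, by simp, ?_⟩,
    fun s hs hsS => absurd ((le_max_left _ _).trans hs) hsS.not_ge⟩
  exact le_max_of_le_right
    (Finset.single_le_sum (f := fun x => dist x x₀) (fun _ _ => dist_nonneg) hx)

lemma exists_farthest (hP : P.Nonempty) (hPE : P ⊂ E) :
    ∃ w ∈ E, w ∉ P ∧ ∃ d, (∀ z ∈ P, d ≤ dist w z) ∧ ∀ x ∈ E, ∃ z ∈ P, dist x z ≤ d := by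
  have attained (x : X) : ∃ z ∈ P, Metric.infDist x P = dist x z :=
    P.finite_toSet.isCompact.exists_infDist_eq_dist hP x
  obtain ⟨v, hvE, hvP⟩ := Finset.exists_of_ssubset hPE
  obtain ⟨w, hwE, hmax⟩ := E.exists_max_image (Metric.infDist · P) ⟨v, hvE⟩
  refine ⟨w, hwE, fun hwP => ?_, Metric.infDist w P,
    fun z hz => Metric.infDist_le_dist_of_mem hz, fun x hx => ?_⟩
  · obtain ⟨z, hz, hvz⟩ := attained v
    have hle := hmax v hvE
    rw [Metric.infDist_zero_of_mem (Finset.mem_coe.2 hwP), hvz] at hle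
    exact hvP (dist_le_zero.1 hle ▸ hz)
  · obtain ⟨z, hz, hxz⟩ := attained x
    exact ⟨z, hz, hxz ▸ hmax x hx⟩

lemma IsPartialNet.exists_insert (h : IsPartialNet E P S r D) (hne : P ≠ E) :
    ∃ Q r' D', IsPartialNet E Q S r' D' ∧ Q.card = P.card + 1 := by
  classical
  obtain ⟨w, hwE, hwP, d, hle, hdense⟩ :=
    exists_farthest h.nonempty (h.subset.ssubset_of_ne hne)
  have hdD : d ≤ D := by
    obtain ⟨z, hz, hwz⟩ := h.dense w hwE
    exact (hle z hz).trans hwz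
  have hold : ∀ z ∈ P, Function.update r w d z = r z := fun z hz =>
    Function.update_of_ne (ne_of_mem_of_not_mem hz hwP) _ _
  refine ⟨insert w P, Function.update r w d, d, ⟨Finset.insert_subset hwE h.subset,
    Finset.insert_nonempty w P, ?_, ?_, fun x hx => ?_, fun s hs hsS x hx => ?_⟩,
    Finset.card_insert_of_notMem hwP⟩
  · intro x hx y hy hxy
    rcases Finset.mem_insert.1 hx with rfl | hxP <;>
      rcases Finset.mem_insert.1 hy with rfl | hyP
    · exact absurd rfl hxy
    · rw [Function.update_self]
      exact (min_le_left _ _).trans (hle y hyP)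
    · rw [Function.update_self, dist_comm]
      exact (min_le_right _ _).trans (hle x hxP)
    · rw [hold x hxP, hold y hyP]
      exact h.separated x hxP y hyP hxy
  · rw [Finset.forall_mem_insert, Function.update_self]
    exact ⟨le_rfl, fun z hz => hold z hz ▸ hdD.trans (h.le_weight z hz)⟩
  · obtain ⟨z, hz, hxz⟩ := hdense x hx
    exact ⟨z, Finset.mem_insert_of_mem hz, hxz⟩
  · rcases le_or_gt D s with hDs | hsD
    · obtain ⟨z, hz, hsz, hxz⟩ := h.dense_of_le s hDs hsS x hx
      exact ⟨z, Finset.mem_insert_of_mem hz, (hold z hz).symm ▸ hsz, hxz⟩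
    · obtain ⟨z, hz, hxz⟩ := hdense x hx
      exact ⟨z, Finset.mem_insert_of_mem hz,
        (hold z hz).symm ▸ hsD.trans_le (h.le_weight z hz), hxz.trans hs⟩

lemma exists_isPartialNet_self (hE : E.Nonempty) (S : ℝ) : ∃ r D, IsPartialNet E E S r D := by
  obtain ⟨x₀, hx₀⟩ := hE
  have hgrow : ∀ k, 1 ≤ k → k ≤ E.card → ∃ P r D, IsPartialNet E P S r D ∧ P.card = k := by
    intro k hk
    induction k, hk using Nat.le_induction with
    | base =>
      obtain ⟨r, D, hnet⟩ := exists_isPartialNet_singleton hx₀ S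
      exact fun _ => ⟨{x₀}, r, D, hnet, Finset.card_singleton x₀⟩
    | succ k _ ih =>
      intro hkE
      obtain ⟨P, r, D, hnet, rfl⟩ := ih (Nat.le_of_succ_le hkE)
      exact hnet.exists_insert (by rintro rfl; omega)
  obtain ⟨P, r, D, hnet, hcard⟩ := hgrow E.card (Finset.card_pos.2 ⟨x₀, hx₀⟩) le_rfl
  obtain rfl := Finset.eq_of_subset_of_card_le hnet.subset hcard.ge
  exact ⟨r, D, hnet⟩

lemma exists_net_weight (E : Finset X) (S : ℝ) :
    ∃ r : X → ℝ, (∀ x ∈ E, ∀ y ∈ E, x ≠ y → min (r x) (r y) ≤ dist x y) ∧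
      ∀ s, 0 < s → s < S → ∀ x ∈ E, ∃ z ∈ E, s < r z ∧ dist x z ≤ s := by
  rcases E.eq_empty_or_nonempty with rfl | hE
  · exact ⟨fun _ => 0, by simp⟩
  obtain ⟨r, D, hnet⟩ := exists_isPartialNet_self hE S
  refine ⟨r, hnet.separated, fun s hs hsS x hx => ?_⟩
  rcases le_or_gt D s with hDs | hsD
  · exact hnet.dense_of_le s hDs hsS x hx
  · exact ⟨x, hx, hsD.trans_le (hnet.le_weight x hx), by rw [dist_self]; exact hs.le⟩

end Nets

/-! ### Walks through neighboring cubes -/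

section Walks

variable {𝒞 W T : Set (DyadicCube n)} {G : Set (Fin n → ℝ)} {Q Q' : DyadicCube n} {B : ℕ}

/-- The cubes of `𝒞` whose closure meets `G`. -/
def meeting (𝒞 : Set (DyadicCube n)) (G : Set (Fin n → ℝ)) : Set (DyadicCube n) :=
  {Q ∈ 𝒞 | (closure Q.toSet ∩ G).Nonempty}

lemma meeting_subset (𝒞 : Set (DyadicCube n)) (G : Set (Fin n → ℝ)) : meeting 𝒞 G ⊆ 𝒞 :=
  Set.sep_subset _ _

lemma meeting_mono {G' : Set (Fin n → ℝ)} (h : G ⊆ G') : meeting 𝒞 G ⊆ meeting 𝒞 G' :=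
  fun _ hQ => ⟨hQ.1, hQ.2.mono (Set.inter_subset_inter_right _ h)⟩

/-- The graph joining distinct neighbors within `W`; the dyadic cubes outside `W` are isolated
vertices. -/
def neighborGraph (W : Set (DyadicCube n)) : SimpleGraph (DyadicCube n) where
  Adj Q Q' := Q ≠ Q' ∧ Q ∈ W ∧ Q' ∈ W ∧ Q.Neighbor Q'
  symm := ⟨fun _ _ h => ⟨h.1.symm, h.2.2.1, h.2.1, h.2.2.2.symm⟩⟩
  loopless := ⟨fun _ h => h.1 rfl⟩

lemma neighborGraph_mono (h : W ⊆ 𝒞) : neighborGraph W ≤ neighborGraph 𝒞 :=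
  fun _ _ hadj => ⟨hadj.1, h hadj.2.1, h hadj.2.2.1, hadj.2.2.2⟩

lemma reachable_of_neighbor (hQ : Q ∈ W) (hQ' : Q' ∈ W) (h : Q.Neighbor Q') :
    (neighborGraph W).Reachable Q Q' := by
  rcases eq_or_ne Q Q' with rfl | hne
  · exact SimpleGraph.Reachable.refl _
  · exact SimpleGraph.Adj.reachable ⟨hne, hQ, hQ', h⟩

lemma mem_of_mem_support (hQ : Q ∈ W) (p : (neighborGraph W).Walk Q Q') {R : DyadicCube n}
    (hR : R ∈ p.support) : R ∈ W := by
  induction p with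
  | nil => simpa using (List.mem_singleton.1 hR) ▸ hQ
  | cons hadj _ ih =>
    rcases List.mem_cons.1 hR with rfl | hR
    · exact hQ
    · exact ih hadj.2.2.1 hR

lemma neighbor_getVert_succ (p : (neighborGraph W).Walk Q Q') (i : ℕ) :
    (p.getVert i).Neighbor (p.getVert (i + 1)) := by
  rcases lt_or_ge i p.length with hi | hi
  · exact (p.adj_getVert_succ hi).2.2.2
  · rw [p.getVert_of_length_le hi, p.getVert_of_length_le (Nat.le_succ_of_le hi)]
    exact DyadicCube.Neighbor.refl Q'

lemma reachable_of_isPreconnected (hfin : 𝒞.Finite) (hG : IsPreconnected G)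
    (hcov : ∀ y ∈ G, ∃ Q ∈ 𝒞, y ∈ closure Q.toSet) (hQ : Q ∈ meeting 𝒞 G)
    (hQ' : Q' ∈ meeting 𝒞 G) : (neighborGraph (meeting 𝒞 G)).Reachable Q Q' := by
  -- If not, the cubes that can be reached from `Q` and the others split `G` into closed parts.
  by_contra hQQ'
  let W := meeting 𝒞 G
  let A : Set (DyadicCube n) := {R ∈ W | (neighborGraph W).Reachable Q R}
  have isClosed_union {V : Set (DyadicCube n)} (hV : V ⊆ W) :
      IsClosed (⋃ R ∈ V, closure R.toSet) :=
    (hfin.subset (hV.trans (meeting_subset 𝒞 G))).isClosed_biUnion fun _ _ => isClosed_closure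
  have hcover : G ⊆ (⋃ R ∈ A, closure R.toSet) ∪ ⋃ R ∈ W \ A, closure R.toSet := by
    intro y hy
    obtain ⟨R, hR, hyR⟩ := hcov y hy
    have hRW : R ∈ W := ⟨hR, y, hyR, hy⟩
    by_cases hRA : R ∈ A
    · exact Or.inl (Set.mem_biUnion hRA hyR)
    · exact Or.inr (Set.mem_biUnion ⟨hRW, hRA⟩ hyR)
  obtain ⟨x, hxQ, hxG⟩ := hQ.2
  obtain ⟨x', hxQ', hxG'⟩ := hQ'.2
  obtain ⟨y, -, hyA, hyB⟩ := isPreconnected_closed_iff.1 hG _ _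
    (isClosed_union (Set.sep_subset _ _)) (isClosed_union Set.sdiff_subset) hcover
    ⟨x, hxG, Set.mem_biUnion ⟨hQ, SimpleGraph.Reachable.refl _⟩ hxQ⟩
    ⟨x', hxG', Set.mem_biUnion ⟨hQ', fun h => hQQ' h.2⟩ hxQ'⟩
  obtain ⟨R, hRA, hyR⟩ := Set.mem_iUnion₂.1 hyA
  obtain ⟨R', hRB, hyR'⟩ := Set.mem_iUnion₂.1 hyB
  exact hRB.2 ⟨hRB.1, hRA.2.trans (reachable_of_neighbor hRA.1 hRB.1 ⟨y, hyR, hyR'⟩)⟩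

/-- `Q` and `Q'` are joined in `𝒞` by at most `B` steps from neighbor to neighbor. -/
def ShortWalk (𝒞 : Set (DyadicCube n)) (B : ℕ) (Q Q' : DyadicCube n) : Prop :=
  ∃ p : (neighborGraph 𝒞).Walk Q Q', p.length ≤ B

lemma ShortWalk.mono (h𝒞 : W ⊆ 𝒞) (h : ShortWalk W B Q Q') : ShortWalk 𝒞 B Q Q' := by
  obtain ⟨p, hp⟩ := h
  exact ⟨p.mapLe (neighborGraph_mono h𝒞), by rwa [SimpleGraph.Walk.length_mapLe]⟩

lemma exists_shortWalk_of_reachable (hQ : Q ∈ W) (hQ' : Q' ∈ T)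
    (hreach : (neighborGraph W).Reachable Q Q') (hB : (W \ T).encard ≤ B) :
    ∃ R ∈ W ∩ T, ShortWalk W B Q R := by
  classical
  obtain ⟨p, hp⟩ := hreach.exists_isPath
  obtain ⟨R, hRT, hRp, hfirst⟩ := p.exists_mem_support_forall_mem_support_imp_eq
    {R ∈ p.support.toFinset | R ∈ T} ⟨Q', by simpa using hQ'⟩
  rw [Finset.mem_filter] at hRT
  refine ⟨R, ⟨mem_of_mem_support hQ p hRp, hRT.2⟩, p.takeUntil R hRp, ?_⟩
  set q := p.takeUntil R hRp
  have hoff : ((q.support.toFinset.erase R : Finset _) : Set (DyadicCube n)) ⊆ W \ T := by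
    intro V hV
    rw [Finset.mem_coe, Finset.mem_erase, List.mem_toFinset] at hV
    refine ⟨mem_of_mem_support hQ q hV.2, fun hVT => hV.1 (hfirst V ?_ hV.2)⟩
    simpa [hVT] using p.support_takeUntil_subset_support hRp hV.2
  have hcard : (q.support.toFinset.erase R).card = q.length := by
    rw [Finset.card_erase_of_mem (by simp), List.toFinset_card_of_nodup
      (hp.takeUntil hRp).support_nodup, q.length_support, Nat.add_sub_cancel]
  have := (Set.encard_le_encard hoff).trans hB
  rw [Set.encard_coe_eq_coe_finsetCard, hcard] at this
  exact_mod_cast this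

end Walks

/-! ### Walks with geometrically decreasing sidelengths -/

section Decay

variable {𝒞 : Set (DyadicCube n)} {Q Q' Q'' : DyadicCube n} {M M' θ : ℝ} {B : ℕ}

/-- The sidelengths of neighbors in `𝒞` differ at most by the factor two. -/
def Balanced (𝒞 : Set (DyadicCube n)) : Prop :=
  ∀ Q ∈ 𝒞, ∀ Q' ∈ 𝒞, Q.Neighbor Q' → Q'.side ≤ 2 * Q.side

lemma Balanced.side_getVert_le (h𝒞 : Balanced 𝒞) (hQ : Q ∈ 𝒞)
    (p : (neighborGraph 𝒞).Walk Q Q') {l k : ℕ} (hlk : l ≤ k) :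
    (p.getVert k).side ≤ 2 ^ (k - l) * (p.getVert l).side ∧
      (p.getVert l).side ≤ 2 ^ (k - l) * (p.getVert k).side := by
  have hmem (i : ℕ) : p.getVert i ∈ 𝒞 := mem_of_mem_support hQ p (p.getVert_mem_support i)
  induction k, hlk using Nat.le_induction with
  | base => simp
  | succ k hlk ih =>
    have hup := h𝒞 _ (hmem k) _ (hmem (k + 1)) (neighbor_getVert_succ p k)
    have hdown := h𝒞 _ (hmem (k + 1)) _ (hmem k) (neighbor_getVert_succ p k).symm
    rw [Nat.sub_add_comm hlk, pow_succ]
    have : (0 : ℝ) < 2 ^ (k - l) := by positivity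
    constructor <;> nlinarith [ih.1, ih.2]

/-- The sidelengths along `p` decrease geometrically at the rate `θ`, up to the factor `M`. -/
def IsDecaying (M θ : ℝ) (p : (neighborGraph 𝒞).Walk Q Q') : Prop :=
  ∀ l k, l ≤ k → k ≤ p.length → (p.getVert k).side ≤ M * θ ^ (k - l) * (p.getVert l).side

/-- `Q` and `Q'` are joined in `𝒞` by a walk with geometrically decreasing sidelengths. -/
def DecayPath (𝒞 : Set (DyadicCube n)) (M θ : ℝ) (Q Q' : DyadicCube n) : Prop :=
  ∃ p : (neighborGraph 𝒞).Walk Q Q', IsDecaying M θ p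

lemma IsDecaying.mono {p : (neighborGraph 𝒞).Walk Q Q'} (hθ : 0 ≤ θ) (hM : M ≤ M')
    (h : IsDecaying M θ p) : IsDecaying M' θ p := fun l k hlk hk => by
  have := (p.getVert l).side_pos
  exact (h l k hlk hk).trans (by gcongr)

lemma IsDecaying.nil (hM : 1 ≤ M) :
    IsDecaying M θ (SimpleGraph.Walk.nil : (neighborGraph 𝒞).Walk Q Q) := by
  intro l k hlk hk
  obtain rfl : k = 0 := by simpa using hk
  obtain rfl : l = 0 := by omega
  rw [Nat.sub_zero, pow_zero, mul_one]
  exact le_mul_of_one_le_left (DyadicCube.side_pos _).le hM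

lemma DecayPath.mono (hθ : 0 ≤ θ) (hM : M ≤ M') (h : DecayPath 𝒞 M θ Q Q') :
    DecayPath 𝒞 M' θ Q Q' :=
  h.imp fun _ hp => hp.mono hθ hM

lemma DecayPath.refl (hM : 1 ≤ M) (Q : DyadicCube n) : DecayPath 𝒞 M θ Q Q :=
  ⟨SimpleGraph.Walk.nil, IsDecaying.nil hM⟩

lemma IsDecaying.append (hθ : 0 ≤ θ) (hM : 1 ≤ M) (hM' : 1 ≤ M')
    {p : (neighborGraph 𝒞).Walk Q Q'} {q : (neighborGraph 𝒞).Walk Q' Q''}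
    (hp : IsDecaying M θ p) (hq : IsDecaying M' θ q) : IsDecaying (M * M') θ (p.append q) := by
  intro l k hlk hk
  rw [SimpleGraph.Walk.length_append] at hk
  rw [p.getVert_append' q, p.getVert_append' q]
  rcases le_or_gt k p.length with hkL | hkL
  · rw [if_pos hkL, if_pos (hlk.trans hkL)]
    exact hp.mono hθ (le_mul_of_one_le_right (by linarith) hM') l k hlk hkL
  rw [if_neg hkL.not_ge]
  rcases le_or_gt l p.length with hlL | hlL
  · have hfirst := hp l p.length hlL le_rfl
    have hsecond := hq 0 (k - p.length) (Nat.zero_le _) (by omega)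
    rw [p.getVert_length] at hfirst
    rw [q.getVert_zero, Nat.sub_zero] at hsecond
    rw [if_pos hlL]
    calc (q.getVert (k - p.length)).side ≤ M' * θ ^ (k - p.length) * Q'.side := hsecond
      _ ≤ M' * θ ^ (k - p.length) * (M * θ ^ (p.length - l) * (p.getVert l).side) := by gcongr
      _ = M * M' * θ ^ (k - p.length + (p.length - l)) * (p.getVert l).side := by
        rw [pow_add]; ring
      _ = M * M' * θ ^ (k - l) * (p.getVert l).side := by
        rw [Nat.sub_add_sub_cancel hkL.le hlL]
  · rw [if_neg hlL.not_ge, ← Nat.sub_sub_sub_cancel_right hlL.le]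
    exact hq.mono hθ (le_mul_of_one_le_left (by linarith) hM) _ _ (by omega) (by omega)

lemma DecayPath.trans (hθ : 0 ≤ θ) (hM : 1 ≤ M) (hM' : 1 ≤ M')
    (h : DecayPath 𝒞 M θ Q Q') (h' : DecayPath 𝒞 M' θ Q' Q'') :
    DecayPath 𝒞 (M * M') θ Q Q'' := by
  obtain ⟨p, hp⟩ := h
  obtain ⟨q, hq⟩ := h'
  exact ⟨p.append q, hp.append hθ hM hM' hq⟩

/-- A rate of decrease along walks that halve the sidelength within every `B` steps, chosen so
that `1 / 2 ≤ rate B ^ B` by Bernoulli's inequality. -/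
def rate (B : ℕ) : ℝ := 1 - 1 / (2 * B)

lemma half_le_rate (hB : 1 ≤ B) : 1 / 2 ≤ rate B := by
  have : (1 : ℝ) ≤ B := by exact_mod_cast hB
  have : 1 / (2 * (B : ℝ)) ≤ 1 / 2 := one_div_le_one_div_of_le two_pos (by linarith)
  rw [rate]
  linarith

lemma rate_lt_one (hB : 1 ≤ B) : rate B < 1 := by
  have : (0 : ℝ) < B := by exact_mod_cast hB
  exact sub_lt_self 1 (by positivity)

lemma half_le_rate_pow (hB : 1 ≤ B) {i : ℕ} (hi : i ≤ B) : 1 / 2 ≤ rate B ^ i := by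
  have : (0 : ℝ) < B := by exact_mod_cast hB
  have hrate := half_le_rate hB
  have bernoulli := one_add_mul_sub_le_pow (a := rate B) (by linarith) B
  have : 1 + (B : ℝ) * (rate B - 1) = 1 / 2 := by rw [rate]; field_simp; ring
  rw [this] at bernoulli
  exact bernoulli.trans (pow_le_pow_of_le_one (by linarith) (rate_lt_one hB).le hi)

lemma two_pow_le_mul_rate_pow (hB : 1 ≤ B) {i : ℕ} (hi : i ≤ B) :
    2 ^ i ≤ 2 ^ (B + 1) * rate B ^ i :=
  calc (2 : ℝ) ^ i ≤ 2 ^ B := pow_le_pow_right₀ one_le_two hi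
    _ = 2 ^ (B + 1) * (1 / 2) := by rw [pow_succ]; ring
    _ ≤ 2 ^ (B + 1) * rate B ^ i := by gcongr; exact half_le_rate_pow hB hi

lemma ShortWalk.decayPath (h𝒞 : Balanced 𝒞) (hB : 1 ≤ B) (hQ : Q ∈ 𝒞)
    (h : ShortWalk 𝒞 B Q Q') : DecayPath 𝒞 (2 ^ (B + 1)) (rate B) Q Q' := by
  obtain ⟨p, hp⟩ := h
  refine ⟨p, fun l k hlk hk => ((h𝒞.side_getVert_le hQ p hlk).1).trans ?_⟩
  have := (p.getVert l).side_pos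
  gcongr
  exact two_pow_le_mul_rate_pow hB (by omega)

/-- A short walk that at least halves the sidelength. -/
def HalfStep (𝒞 : Set (DyadicCube n)) (B : ℕ) (Q Q' : DyadicCube n) : Prop :=
  ShortWalk 𝒞 B Q Q' ∧ Q'.side ≤ Q.side / 2

/-- The induction hypothesis for concatenations of half steps: decay with a better constant from
the first cube, and with the constant of `IsDecaying` between any two cubes. -/
structure IsSteep (B : ℕ) (p : (neighborGraph 𝒞).Walk Q Q') : Prop where
  side_le : ∀ k ≤ p.length, (p.getVert k).side ≤ 2 ^ (B + 1) * rate B ^ k * Q.side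
  isDecaying : IsDecaying (2 ^ (2 * B + 1)) (rate B) p

lemma side_getVert_append_le (h𝒞 : Balanced 𝒞) (hB : 1 ≤ B) (hQ : Q ∈ 𝒞)
    {p : (neighborGraph 𝒞).Walk Q Q'} (hp : p.length ≤ B) (hhalf : Q'.side ≤ Q.side / 2)
    {q : (neighborGraph 𝒞).Walk Q' Q''} (hq : IsSteep B q) {k : ℕ}
    (hk : k ≤ (p.append q).length) :
    ((p.append q).getVert k).side ≤ 2 ^ (B + 1) * rate B ^ k * Q.side := by
  have hQpos := Q.side_pos
  have hθ : 0 ≤ rate B := by linarith [half_le_rate hB]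
  rw [SimpleGraph.Walk.length_append] at hk
  rw [p.getVert_append' q]
  split_ifs with hkp
  · have hside := (h𝒞.side_getVert_le hQ p (Nat.zero_le k)).1
    rw [p.getVert_zero, Nat.sub_zero] at hside
    refine hside.trans ?_
    gcongr
    exact two_pow_le_mul_rate_pow hB (hkp.trans hp)
  · calc (q.getVert (k - p.length)).side
        ≤ 2 ^ (B + 1) * rate B ^ (k - p.length) * Q'.side := hq.side_le _ (by omega)
      _ ≤ 2 ^ (B + 1) * rate B ^ (k - p.length) * (1 / 2 * Q.side) := by gcongr; linarith
      _ ≤ 2 ^ (B + 1) * rate B ^ (k - p.length) * (rate B ^ p.length * Q.side) := by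
        gcongr
        exact half_le_rate_pow hB hp
      _ = 2 ^ (B + 1) * rate B ^ (k - p.length + p.length) * Q.side := by rw [pow_add]; ring
      _ = 2 ^ (B + 1) * rate B ^ k * Q.side := by rw [Nat.sub_add_cancel (not_le.1 hkp).le]

lemma IsSteep.append (h𝒞 : Balanced 𝒞) (hB : 1 ≤ B) (hQ : Q ∈ 𝒞)
    {p : (neighborGraph 𝒞).Walk Q Q'} (hp : p.length ≤ B) (hhalf : Q'.side ≤ Q.side / 2)
    {q : (neighborGraph 𝒞).Walk Q' Q''} (hq : IsSteep B q) : IsSteep B (p.append q) := by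
  have hθ : 0 ≤ rate B := by linarith [half_le_rate hB]
  have hfrom_start := fun k hk => side_getVert_append_le h𝒞 hB hQ hp hhalf hq (k := k) hk
  refine ⟨hfrom_start, fun l k hlk hk => ?_⟩
  rcases le_or_gt l p.length with hlp | hlp
  · have hstart := (h𝒞.side_getVert_le hQ (p.append q) (Nat.zero_le l)).2
    rw [SimpleGraph.Walk.getVert_zero, Nat.sub_zero] at hstart
    calc ((p.append q).getVert k).side ≤ 2 ^ (B + 1) * rate B ^ k * Q.side := hfrom_start k hk
      _ ≤ 2 ^ (B + 1) * rate B ^ (k - l) * (2 ^ B * ((p.append q).getVert l).side) := by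
        refine mul_le_mul ?_ (hstart.trans ?_) Q.side_pos.le (by positivity)
        · gcongr _ * ?_
          exact pow_le_pow_of_le_one hθ (rate_lt_one hB).le (Nat.sub_le k l)
        · have := (DyadicCube.side_pos ((p.append q).getVert l)).le
          have : (2 : ℝ) ^ l ≤ 2 ^ B := pow_le_pow_right₀ one_le_two (hlp.trans hp)
          gcongr
      _ = 2 ^ (2 * B + 1) * rate B ^ (k - l) * ((p.append q).getVert l).side := by ring
  · rw [SimpleGraph.Walk.length_append] at hk
    rw [p.getVert_append' q, p.getVert_append' q, if_neg (by omega), if_neg (by omega),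
      ← Nat.sub_sub_sub_cancel_right hlp.le]
    exact hq.isDecaying _ _ (by omega) (by omega)

lemma decayPath_of_halfSteps (h𝒞 : Balanced 𝒞) (hB : 1 ≤ B) (hQ : Q ∈ 𝒞)
    (h : Relation.ReflTransGen (HalfStep 𝒞 B) Q Q') :
    DecayPath 𝒞 (2 ^ (2 * B + 1)) (rate B) Q Q' := by
  suffices ∃ p : (neighborGraph 𝒞).Walk Q Q', IsSteep B p from this.imp fun _ hp => hp.isDecaying
  induction h using Relation.ReflTransGen.head_induction_on with
  | refl =>
    refine ⟨SimpleGraph.Walk.nil, fun k hk => ?_, IsDecaying.nil (one_le_pow₀ one_le_two)⟩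
    obtain rfl : k = 0 := by simpa using hk
    rw [pow_zero, mul_one]
    exact le_mul_of_one_le_left (DyadicCube.side_pos _).le (one_le_pow₀ one_le_two)
  | head hstep _ ih =>
    obtain ⟨⟨p, hp⟩, hhalf⟩ := hstep
    obtain ⟨q, hq⟩ := ih (mem_of_mem_support hQ p p.end_mem_support)
    exact ⟨p.append q, hq.append h𝒞 hB hQ hp hhalf⟩

end Decay

/-! ### Whitney families -/

/-- The geometry of the decomposition `CZ°`: finitely many dyadic cubes covering the unit cube,
whose sidelengths vary slowly, each close to a point of `E`. -/
structure IsWhitney (𝒞 : Set (DyadicCube n)) (E : Finset (Fin n → ℝ)) : Prop where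
  finite : 𝒞.Finite
  exists_mem : ∀ y ∈ (DyadicCube.unit n).toSet, ∃ Q ∈ 𝒞, y ∈ Q.toSet
  subset_unit : ∀ Q ∈ 𝒞, Q.toSet ⊆ (DyadicCube.unit n).toSet
  side_lt : ∀ Q ∈ 𝒞, ∀ Q' ∈ 𝒞, Q'.side < 2 / 3 * ‖Q.center - Q'.center‖ + 7 / 3 * Q.side
  exists_near : ∀ Q ∈ 𝒞, ∃ x ∈ E, ‖x - Q.center‖ ≤ 7 / 2 * Q.side
  side_le_half : ∀ Q ∈ 𝒞, Q.side ≤ 1 / 2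
  norm_sub_le : ∀ x ∈ E, ‖x - (DyadicCube.unit n).center‖ ≤ 1 / 16

/-- A bound for the number of steps of the walks below that stay at one scale. -/
def walkBound (n : ℕ) : ℕ := packingBound n 512

lemma one_le_walkBound (n : ℕ) : 1 ≤ walkBound n := Nat.one_le_pow _ _ (by omega)

/-- The rate of decrease `1 - c` of the sidelengths along the sequences of the theorem. -/
def decayRate (n : ℕ) : ℝ := rate (walkBound n)

/-- The factor for a single piece of these sequences, a run of half steps or a short walk. -/
def decayConst (n : ℕ) : ℝ := 2 ^ (2 * walkBound n + 1)

lemma decayRate_pos (n : ℕ) : 0 < decayRate n :=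
  one_half_pos.trans_le (half_le_rate (one_le_walkBound n))

lemma decayRate_lt_one (n : ℕ) : decayRate n < 1 := rate_lt_one (one_le_walkBound n)

lemma one_le_decayConst (n : ℕ) : 1 ≤ decayConst n := one_le_pow₀ one_le_two

namespace IsWhitney

variable {𝒞 T : Set (DyadicCube n)} {E : Finset (Fin n → ℝ)} {Q Q' : DyadicCube n}
  {G : Set (Fin n → ℝ)} {a : ℝ} {x y z : Fin n → ℝ}

lemma balanced (h : IsWhitney 𝒞 E) : Balanced 𝒞 := by
  intro Q hQ Q' hQ' hnbr
  apply DyadicCube.side_le_two_mul_of_lt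
  linarith [h.side_lt Q hQ Q' hQ', hnbr.norm_center_sub_le]

lemma decayPath_of_shortWalk (h : IsWhitney 𝒞 E) (hQ : Q ∈ 𝒞)
    (hwalk : ShortWalk 𝒞 (walkBound n) Q Q') : DecayPath 𝒞 (decayConst n) (decayRate n) Q Q' :=
  (hwalk.decayPath h.balanced (one_le_walkBound n) hQ).mono (decayRate_pos n).le
    (pow_le_pow_right₀ one_le_two (by omega))

lemma decayPath_of_halfSteps (h : IsWhitney 𝒞 E) (hQ : Q ∈ 𝒞)
    (hsteps : Relation.ReflTransGen (HalfStep 𝒞 (walkBound n)) Q Q') :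
    DecayPath 𝒞 (decayConst n) (decayRate n) Q Q' :=
  SobolevExt.decayPath_of_halfSteps h.balanced (one_le_walkBound n) hQ hsteps

lemma center_mem_unit (h : IsWhitney 𝒞 E) (hQ : Q ∈ 𝒞) : Q.center ∈ (DyadicCube.unit n).toSet :=
  h.subset_unit Q hQ Q.center_mem

lemma encard_neighbors_le (h : IsWhitney 𝒞 E) (hQ : Q ∈ 𝒞) :
    {Q' ∈ 𝒞 | Q.Neighbor Q'}.encard ≤ packingBound n 4 := by
  refine (Set.encard_le_encard ?_).trans (encard_nearScale_le (half_pos Q.side_pos) Q.center)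
  rintro Q' ⟨hQ', hnbr⟩
  have hup := h.balanced Q hQ Q' hQ' hnbr
  have hdown := h.balanced Q' hQ' Q hQ hnbr.symm
  have hdist := hnbr.symm.norm_center_sub_le
  exact ⟨by linarith, by linarith, by linarith⟩

lemma reachable_meeting (h : IsWhitney 𝒞 E) (hG : IsPreconnected G)
    (hGunit : G ⊆ (DyadicCube.unit n).toSet) (hQ : Q ∈ meeting 𝒞 G) (hQ' : Q' ∈ meeting 𝒞 G) :
    (neighborGraph (meeting 𝒞 G)).Reachable Q Q' :=
  reachable_of_isPreconnected h.finite hG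
    (fun y hy => (h.exists_mem y (hGunit hy)).imp fun _ hR => ⟨hR.1, subset_closure hR.2⟩) hQ hQ'

lemma exists_shortWalk (h : IsWhitney 𝒞 E) (hG : IsPreconnected G)
    (hGunit : G ⊆ (DyadicCube.unit n).toSet) (ha : 0 < a)
    (hscale : meeting 𝒞 G \ T ⊆ nearScale 512 a z) (hQ : Q ∈ meeting 𝒞 G)
    (hQ' : Q' ∈ meeting 𝒞 G) (hQ'T : Q' ∈ T) :
    ∃ R ∈ meeting 𝒞 G ∩ T, ShortWalk 𝒞 (walkBound n) Q R := by
  obtain ⟨R, hR, hwalk⟩ := exists_shortWalk_of_reachable hQ hQ'T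
    (h.reachable_meeting hG hGunit hQ hQ')
    ((Set.encard_le_encard hscale).trans (encard_nearScale_le ha z))
  exact ⟨R, hR, hwalk.mono (meeting_subset 𝒞 G)⟩

lemma exists_halfStep (h : IsWhitney 𝒞 E) (hQ : Q ∈ 𝒞) (hkey : Q ∉ keystone 𝒞) :
    ∃ Q' ∈ 𝒞, HalfStep 𝒞 (walkBound n) Q Q' := by
  have hpos := Q.side_pos
  obtain ⟨Q', hQ', ⟨y, hyQ', hyQ⟩, hlt⟩ :
      ∃ Q' ∈ 𝒞, (Q'.toSet ∩ Q.dilate 100).Nonempty ∧ Q'.side < Q.side := by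
    by_contra! hall
    exact hkey ⟨hQ, hall⟩
  have hy := DyadicCube.norm_sub_center_le_of_mem_dilate (by norm_num) hyQ
  let G := (DyadicCube.unit n).toSet ∩ Metric.closedBall Q.center (50 * Q.side)
  have hG : IsPreconnected G :=
    ((DyadicCube.unit n).convex_toSet.inter (convex_closedBall _ _)).isPreconnected
  have hscale : meeting 𝒞 G \ {R | R.side < Q.side} ⊆ nearScale 512 Q.side Q.center := by
    rintro R ⟨⟨hR, w, hwR, -, hwQ⟩, hlarge⟩
    rw [Set.mem_ofPred_eq, not_lt] at hlarge
    rw [mem_closedBall_iff_norm'] at hwQ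
    have hwR := DyadicCube.norm_sub_center_le_of_mem_closure hwR
    have hside := h.side_lt Q hQ R hR
    have := norm_sub_le_norm_sub_add_norm_sub Q.center w R.center
    rw [nearScale, Set.mem_ofPred_eq, norm_sub_rev R.center]
    exact ⟨hlarge, by linarith, by linarith⟩
  obtain ⟨R, hR, hwalk⟩ := h.exists_shortWalk hG Set.inter_subset_left hpos hscale
    (Q := Q) ⟨hQ, Q.center, subset_closure Q.center_mem, h.center_mem_unit hQ,
      Metric.mem_closedBall_self (by positivity)⟩
    (Q' := Q') ⟨hQ', y, subset_closure hyQ', h.subset_unit Q' hQ' hyQ',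
      mem_closedBall_iff_norm.2 (by linarith)⟩ hlt
  exact ⟨R, hR.1.1, hwalk, DyadicCube.side_le_half_of_lt hR.2⟩

lemma exists_keystone (h : IsWhitney 𝒞 E) (hQ : Q ∈ 𝒞) :
    ∃ K ∈ keystone 𝒞, Relation.ReflTransGen (HalfStep 𝒞 (walkBound n)) Q K ∧
      (Q ∈ keystone 𝒞 → K = Q) := by
  induction hN : {R ∈ 𝒞 | R.side < Q.side}.ncard using Nat.strong_induction_on generalizing Q with
  | _ N ih =>
    by_cases hkey : Q ∈ keystone 𝒞
    · exact ⟨Q, hkey, Relation.ReflTransGen.refl, fun _ => rfl⟩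
    obtain ⟨Q₁, hQ₁, hstep⟩ := h.exists_halfStep hQ hkey
    have hlt : Q₁.side < Q.side := by linarith [hstep.2, Q.side_pos]
    have hfewer : {R ∈ 𝒞 | R.side < Q₁.side}.ncard < N := by
      rw [← hN]
      refine Set.ncard_lt_ncard ⟨fun R hR => ⟨hR.1, hR.2.trans hlt⟩, fun hsub => ?_⟩
        (h.finite.subset (Set.sep_subset _ _))
      exact lt_irrefl _ (hsub ⟨hQ₁, hlt⟩).2
    obtain ⟨K, hK, hpath, -⟩ := ih _ hfewer hQ₁ rfl
    exact ⟨K, hK, hpath.head hstep, fun hQkey => absurd hQkey hkey⟩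

lemma mem_unit_of_norm_sub_le (h : IsWhitney 𝒞 E) (hx : x ∈ E) (hy : ‖y - x‖ ≤ 1 / 8) :
    y ∈ (DyadicCube.unit n).toSet := by
  apply DyadicCube.mem_of_norm_sub_center_lt
  rw [DyadicCube.side_unit]
  linarith [h.norm_sub_le x hx,
    norm_sub_le_norm_sub_add_norm_sub y x (DyadicCube.unit n).center]

lemma exists_mem_of_mem (h : IsWhitney 𝒞 E) (hx : x ∈ E) : ∃ Q ∈ 𝒞, x ∈ Q.toSet :=
  h.exists_mem x (h.mem_unit_of_norm_sub_le hx (by simp))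

end IsWhitney

/-! ### Interstitial cubes -/

/-- The point `x` lies in a cube of `𝒞` of sidelength less than a hundredth of that of `Q`. -/
def HasSmallCube (𝒞 : Set (DyadicCube n)) (Q : DyadicCube n) (x : Fin n → ℝ) : Prop :=
  ∃ R ∈ 𝒞, x ∈ R.toSet ∧ 100 * R.side < Q.side

/-- Seen from `Q`, the set `E` is a single small cluster. -/
def IsClustered (E : Finset (Fin n → ℝ)) (Q : DyadicCube n) : Prop :=
  ∀ x ∈ E, ∀ y ∈ E, ‖x - Q.center‖ ≤ 16 * Q.side → ‖y - Q.center‖ ≤ 16 * Q.side →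
    ‖x - y‖ < Q.side / 32

/-- The cubes of `𝒞` around which `E` is a single small cluster, near which there are much smaller
cubes of `𝒞`. -/
def interstitial (𝒞 : Set (DyadicCube n)) (E : Finset (Fin n → ℝ)) : Set (DyadicCube n) :=
  {Q ∈ 𝒞 | (∀ x ∈ E, ‖x - Q.center‖ ≤ 4 * Q.side → HasSmallCube 𝒞 Q x) ∧ IsClustered E Q}

lemma exists_separated_of_not_isClustered {E : Finset (Fin n → ℝ)} {Q : DyadicCube n}
    {r : (Fin n → ℝ) → ℝ} (hr : ∀ x ∈ E, ∃ z ∈ E, Q.side / 128 < r z ∧ dist x z ≤ Q.side / 128)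
    (hQ : ¬ IsClustered E Q) :
    ∃ x ∈ E, ∃ y ∈ E, x ≠ y ∧ (Q.side / 128 < r x ∧ ‖Q.center - x‖ ≤ 17 * Q.side) ∧
      (Q.side / 128 < r y ∧ ‖Q.center - y‖ ≤ 17 * Q.side) := by
  have hpos := Q.side_pos
  simp only [IsClustered, not_forall, not_lt] at hQ
  obtain ⟨x, hx, y, hy, hxQ, hyQ, hxy⟩ := hQ
  obtain ⟨x', hx', hrx', hxx'⟩ := hr x hx
  obtain ⟨y', hy', hry', hyy'⟩ := hr y hy
  rw [← dist_eq_norm] at hxQ hyQ hxy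
  refine ⟨x', hx', y', hy', ?_, ⟨hrx', ?_⟩, hry', ?_⟩
  · rintro rfl
    linarith [dist_triangle_right x y x']
  · rw [← dist_eq_norm]
    linarith [dist_triangle_left Q.center x' x]
  · rw [← dist_eq_norm]
    linarith [dist_triangle_left Q.center y' y]

lemma encard_not_isClustered_le (E : Finset (Fin n → ℝ)) (s : ℝ) :
    {Q : DyadicCube n | Q.side ≤ s ∧ ¬ IsClustered E Q}.encard
      ≤ (E.card * packingBound n 262144 : ℕ) := by
  obtain ⟨r, hsep, hdense⟩ := exists_net_weight E s
  refine encard_le_of_forall_exists_nearScale (a := fun x => r x / 64) fun Q ⟨hQs, hQ⟩ => ?_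
  have hpos := Q.side_pos
  obtain ⟨x, hx, y, hy, hne, ⟨hrx, hxQ⟩, hry, hyQ⟩ := exists_separated_of_not_isClustered
    (hdense (Q.side / 128) (by positivity) (by linarith)) hQ
  have hdist : dist x y ≤ 34 * Q.side := by
    rw [← dist_eq_norm] at hxQ hyQ
    linarith [dist_triangle_left x y Q.center]
  rcases min_le_iff.1 ((hsep x hx y hy hne).trans hdist) with hmin | hmin
  · exact ⟨x, hx, by linarith, by linarith, by linarith, by linarith⟩
  · exact ⟨y, hy, by linarith, by linarith, by linarith, by linarith⟩

/-- A bound for the number of cubes that are not interstitial, per point of `E`. -/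
def exceptionalBound (n : ℕ) : ℕ := packingBound n 3200 + packingBound n 262144

namespace IsWhitney

variable {𝒞 : Set (DyadicCube n)} {E : Finset (Fin n → ℝ)}

lemma encard_not_hasSmallCube_le (h : IsWhitney 𝒞 E) :
    {Q ∈ 𝒞 | ∃ x ∈ E, ‖x - Q.center‖ ≤ 4 * Q.side ∧ ¬ HasSmallCube 𝒞 Q x}.encard
      ≤ (E.card * packingBound n 3200 : ℕ) := by
  choose! R hR𝒞 hxR using fun x (hx : x ∈ E) => h.exists_mem_of_mem hx
  refine encard_le_of_forall_exists_nearScale (a := fun x => (R x).side / 8) ?_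
  rintro Q ⟨hQ, x, hx, hxQ, hlarge⟩
  have hQR : Q.side ≤ 100 * (R x).side :=
    not_lt.1 fun hlt => hlarge ⟨R x, hR𝒞 x hx, hxR x hx, hlt⟩
  have hpos := (R x).side_pos
  have hside := h.side_lt Q hQ (R x) (hR𝒞 x hx)
  have hcenter := DyadicCube.norm_sub_center_le_of_mem (hxR x hx)
  have := norm_sub_le_norm_sub_add_norm_sub Q.center x (R x).center
  rw [norm_sub_rev] at hxQ
  exact ⟨x, hx, by linarith, by linarith, by linarith, by linarith⟩

lemma encard_diff_interstitial_le (h : IsWhitney 𝒞 E) :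
    (𝒞 \ interstitial 𝒞 E).encard ≤ (E.card * exceptionalBound n : ℕ) := by
  have hsub : 𝒞 \ interstitial 𝒞 E ⊆
      {Q ∈ 𝒞 | ∃ x ∈ E, ‖x - Q.center‖ ≤ 4 * Q.side ∧ ¬ HasSmallCube 𝒞 Q x} ∪
        {Q | Q.side ≤ 1 / 2 ∧ ¬ IsClustered E Q} := by
    rintro Q ⟨hQ, hnot⟩
    by_cases hcl : IsClustered E Q
    · left
      by_contra! hall
      refine hnot ⟨hQ, fun x hx hxQ => ?_, hcl⟩
      by_contra hlarge
      exact hall ⟨hQ, x, hx, hxQ, hlarge⟩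
    · exact Or.inr ⟨h.side_le_half Q hQ, hcl⟩
  refine (Set.encard_le_encard hsub).trans ((Set.encard_union_le _ _).trans ?_)
  rw [exceptionalBound, mul_add, Nat.cast_add]
  exact add_le_add h.encard_not_hasSmallCube_le (encard_not_isClustered_le E _)

end IsWhitney

/-! ### Poles -/

/-- Seen from `Q`, the set `E` is a cluster of diameter at most `r` around its point `x`, and `x`
lies in a cube of `𝒞` of sidelength at most `r / 4`. -/
structure IsPole (𝒞 : Set (DyadicCube n)) (E : Finset (Fin n → ℝ)) (Q : DyadicCube n)
    (x : Fin n → ℝ) (r : ℝ) : Prop where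
  mem : x ∈ E
  pos : 0 < r
  le_side : r ≤ Q.side / 4
  norm_sub_le : ‖Q.center - x‖ ≤ 4 * Q.side
  side_le_norm_sub : Q.side ≤ ‖Q.center - x‖
  exists_small_cube : ∃ R ∈ 𝒞, x ∈ R.toSet ∧ 4 * R.side ≤ r
  cluster : ∀ e ∈ E, ‖e - Q.center‖ ≤ 16 * Q.side → 2 * ‖e - x‖ ≤ r

/-- The points of `E` near the cube `Q`; neighboring interstitial cubes have the same ones. -/
def nearPoints (E : Finset (Fin n → ℝ)) (Q : DyadicCube n) : Finset (Fin n → ℝ) :=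
  E.filter fun x => ‖x - Q.center‖ ≤ 16 * Q.side

/-- The radial projection to the sphere of radius `r` about `x`; it moves along the ray from `x`
through `y` as `r` varies. -/
def radialProj (x : Fin n → ℝ) (r : ℝ) (y : Fin n → ℝ) : Fin n → ℝ :=
  x + (r / ‖y - x‖) • (y - x)

lemma norm_radialProj_sub {x y : Fin n → ℝ} {r : ℝ} (hr : 0 ≤ r) (hy : y ≠ x) :
    ‖radialProj x r y - x‖ = r := by
  have : 0 < ‖y - x‖ := norm_pos_iff.2 (sub_ne_zero.2 hy)
  rw [radialProj, add_sub_cancel_left, norm_smul, Real.norm_of_nonneg (by positivity)]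
  field_simp

lemma radialProj_norm_sub {x y : Fin n → ℝ} (hy : y ≠ x) : radialProj x ‖y - x‖ y = y := by
  rw [radialProj, div_self (norm_ne_zero_iff.2 (sub_ne_zero.2 hy)), one_smul, add_sub_cancel]

lemma continuousOn_radialProj (x : Fin n → ℝ) (r : ℝ) :
    ContinuousOn (radialProj x r) {x}ᶜ := by
  have : ContinuousOn (fun y => r / ‖y - x‖) {x}ᶜ :=
    ContinuousOn.div₀ (by fun_prop) (by fun_prop) fun y hy =>
      norm_ne_zero_iff.2 (sub_ne_zero.2 hy)
  unfold radialProj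
  fun_prop

lemma continuous_radialProj_radius (x y : Fin n → ℝ) : Continuous (radialProj x · y) := by
  unfold radialProj
  fun_prop

/-- The cubes meeting the sphere of radius `r` about `x` that are connected, along the sphere, to
the radial projection of `Q`. -/
def sphereComponent (𝒞 : Set (DyadicCube n)) (x : Fin n → ℝ) (r : ℝ) (Q : DyadicCube n) :
    Set (DyadicCube n) :=
  {Q' | ∃ Q₁ ∈ meeting 𝒞 (radialProj x r '' closure Q.toSet),
    (neighborGraph (meeting 𝒞 (Metric.sphere x r))).Reachable Q₁ Q'}

namespace IsPole

variable {𝒞 : Set (DyadicCube n)} {E : Finset (Fin n → ℝ)} {Q Q' Q₁ Q₂ R : DyadicCube n}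
  {x y : Fin n → ℝ} {r a t t₁ t₂ : ℝ}

lemma norm_le_eight_mul_side (h : IsWhitney 𝒞 E) (hx : IsPole 𝒞 E Q x r) (hR : R ∈ 𝒞)
    (hy : y ∈ closure R.toSet) (hry : r ≤ ‖y - x‖) (hyQ : ‖y - x‖ ≤ 4 * Q.side) :
    ‖y - x‖ ≤ 8 * R.side := by
  by_contra! hlt
  -- Otherwise `R` would be close to a point of `E` outside the cluster around `x`.
  obtain ⟨e, he, heR⟩ := h.exists_near R hR
  have hyR := DyadicCube.norm_sub_center_le_of_mem_closure hy
  have hxQ := hx.norm_sub_le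
  have hey : ‖e - y‖ ≤ 4 * R.side := by
    rw [norm_sub_rev] at hyR
    linarith [norm_sub_le_norm_sub_add_norm_sub e R.center y]
  have heQ : ‖e - Q.center‖ ≤ 16 * Q.side := by
    rw [norm_sub_rev] at hxQ
    linarith [norm_sub_le_norm_sub_add_norm_sub e y Q.center, Q.side_pos,
      norm_sub_le_norm_sub_add_norm_sub y x Q.center]
  rw [norm_sub_rev] at hey
  linarith [hx.cluster e he heQ, hx.pos, norm_sub_le_norm_sub_add_norm_sub y e x]

lemma side_le_two_mul_norm (h : IsWhitney 𝒞 E) (hx : IsPole 𝒞 E Q x r) (hR : R ∈ 𝒞)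
    (hy : y ∈ closure R.toSet) (hry : r ≤ ‖y - x‖) : R.side ≤ 2 * ‖y - x‖ := by
  obtain ⟨R₀, hR₀, hxR₀, hR₀r⟩ := hx.exists_small_cube
  have hside := h.side_lt R₀ hR₀ R hR
  have hxR₀ := DyadicCube.norm_sub_center_le_of_mem hxR₀
  have hyR := DyadicCube.norm_sub_center_le_of_mem_closure hy
  rw [norm_sub_rev R₀.center] at hside
  rw [norm_sub_rev] at hyR
  linarith [norm_sub_le_norm_sub_add_norm_sub R.center y R₀.center,
    norm_sub_le_norm_sub_add_norm_sub y x R₀.center]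

lemma mem_nearScale (h : IsWhitney 𝒞 E) (hx : IsPole 𝒞 E Q x r) (hR : R ∈ 𝒞)
    (hy : y ∈ closure R.toSet) (hry : r ≤ ‖y - x‖) (hyQ : ‖y - x‖ ≤ 4 * Q.side)
    (ha : 8 * a ≤ ‖y - x‖) (ha' : ‖y - x‖ ≤ 256 * a) : R ∈ nearScale 512 a x := by
  have hlower := hx.norm_le_eight_mul_side h hR hy hry hyQ
  have hupper := hx.side_le_two_mul_norm h hR hy hry
  have hyR := DyadicCube.norm_sub_center_le_of_mem_closure hy
  rw [norm_sub_rev] at hyR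
  exact ⟨by linarith, by linarith,
    by linarith [norm_sub_le_norm_sub_add_norm_sub R.center y x]⟩

lemma ne_of_mem_closure (hx : IsPole 𝒞 E Q x r) (hy : y ∈ closure Q.toSet) : y ≠ x := by
  rintro rfl
  have := DyadicCube.norm_sub_center_le_of_mem_closure hy
  rw [norm_sub_rev] at this
  linarith [hx.side_le_norm_sub, Q.side_pos]

lemma center_ne (hx : IsPole 𝒞 E Q x r) : Q.center ≠ x :=
  hx.ne_of_mem_closure (subset_closure Q.center_mem)

lemma sphere_subset_unit (h : IsWhitney 𝒞 E) (hQ : Q ∈ 𝒞) (hx : IsPole 𝒞 E Q x r) :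
    Metric.sphere x r ⊆ (DyadicCube.unit n).toSet := fun y hy =>
  h.mem_unit_of_norm_sub_le hx.mem <| by
    linarith [mem_sphere_iff_norm.1 hy, hx.le_side, h.side_le_half Q hQ]

lemma image_radialProj_subset_sphere (hx : IsPole 𝒞 E Q x r) :
    radialProj x r '' closure Q.toSet ⊆ Metric.sphere x r := by
  rintro _ ⟨y, hy, rfl⟩
  exact mem_sphere_iff_norm.2 (norm_radialProj_sub hx.pos.le (hx.ne_of_mem_closure hy))

lemma radialProj_center_mem (x : Fin n → ℝ) (r : ℝ) (Q : DyadicCube n) :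
    radialProj x r Q.center ∈ radialProj x r '' closure Q.toSet :=
  Set.mem_image_of_mem _ (subset_closure Q.center_mem)

lemma reachable_of_neighbor (h : IsWhitney 𝒞 E) (hQ : Q ∈ 𝒞) (hx : IsPole 𝒞 E Q x r)
    (hx' : IsPole 𝒞 E Q' x r) (hnbr : Q.Neighbor Q')
    (hQ₁ : Q₁ ∈ meeting 𝒞 (radialProj x r '' closure Q.toSet))
    (hQ₂ : Q₂ ∈ meeting 𝒞 (radialProj x r '' closure Q'.toSet)) :
    (neighborGraph (meeting 𝒞 (Metric.sphere x r))).Reachable Q₁ Q₂ := by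
  let G := radialProj x r '' (closure Q.toSet ∪ closure Q'.toSet)
  have hG : IsPreconnected G := by
    obtain ⟨y, hy, hy'⟩ := hnbr
    refine (IsPreconnected.union y hy hy' Q.isPreconnected_closure
      Q'.isPreconnected_closure).image _ ((continuousOn_radialProj x r).mono ?_)
    exact Set.union_subset (fun _ => hx.ne_of_mem_closure) fun _ => hx'.ne_of_mem_closure
  have hsphere : G ⊆ Metric.sphere x r := by
    simp only [G, Set.image_union]
    exact Set.union_subset hx.image_radialProj_subset_sphere hx'.image_radialProj_subset_sphere
  exact (h.reachable_meeting hG (hsphere.trans (hx.sphere_subset_unit h hQ))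
    (meeting_mono (Set.image_mono Set.subset_union_left) hQ₁)
    (meeting_mono (Set.image_mono Set.subset_union_right) hQ₂)).mono
    (neighborGraph_mono (meeting_mono hsphere))

lemma exists_mem_meeting_radialProj (h : IsWhitney 𝒞 E) (hQ : Q ∈ 𝒞) (hx : IsPole 𝒞 E Q x r) :
    (meeting 𝒞 (radialProj x r '' closure Q.toSet)).Nonempty := by
  have hmem := radialProj_center_mem x r Q
  obtain ⟨Q₁, hQ₁, hy⟩ := h.exists_mem _
    (hx.sphere_subset_unit h hQ (hx.image_radialProj_subset_sphere hmem))
  exact ⟨Q₁, hQ₁, _, subset_closure hy, hmem⟩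

lemma sphereComponent_nonempty (h : IsWhitney 𝒞 E) (hQ : Q ∈ 𝒞) (hx : IsPole 𝒞 E Q x r) :
    (sphereComponent 𝒞 x r Q).Nonempty := by
  obtain ⟨Q₁, hQ₁⟩ := hx.exists_mem_meeting_radialProj h hQ
  exact ⟨Q₁, Q₁, hQ₁, SimpleGraph.Reachable.refl _⟩

lemma sphereComponent_subset (h : IsWhitney 𝒞 E) (hQ : Q ∈ 𝒞) (hQ' : Q' ∈ 𝒞)
    (hx : IsPole 𝒞 E Q x r) (hx' : IsPole 𝒞 E Q' x r) (hnbr : Q.Neighbor Q') :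
    sphereComponent 𝒞 x r Q ⊆ sphereComponent 𝒞 x r Q' := by
  rintro R ⟨Q₁, hQ₁, hreach⟩
  obtain ⟨Q₂, hQ₂⟩ := hx'.exists_mem_meeting_radialProj h hQ'
  exact ⟨Q₂, hQ₂, (hx.reachable_of_neighbor h hQ hx' hnbr hQ₁ hQ₂).symm.trans hreach⟩

lemma shortWalk_of_reachable (h : IsWhitney 𝒞 E) (hx : IsPole 𝒞 E Q x r)
    (hQ₁ : Q₁ ∈ meeting 𝒞 (Metric.sphere x r))
    (hreach : (neighborGraph (meeting 𝒞 (Metric.sphere x r))).Reachable Q₁ Q₂) :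
    ShortWalk 𝒞 (walkBound n) Q₁ Q₂ := by
  have hr := hx.pos
  have hscale : meeting 𝒞 (Metric.sphere x r) ⊆ nearScale 512 (r / 8) x := by
    rintro R ⟨hR, y, hyR, hyr⟩
    have hyr := mem_sphere_iff_norm.1 hyr
    exact hx.mem_nearScale h hR hyR hyr.ge (by linarith [hx.le_side]) (by linarith) (by linarith)
  obtain ⟨R, ⟨-, rfl⟩, hwalk⟩ := exists_shortWalk_of_reachable hQ₁ (Set.mem_singleton Q₂) hreach
    ((Set.encard_le_encard (Set.sdiff_subset.trans hscale)).trans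
      (encard_nearScale_le (by positivity) x))
  exact hwalk.mono (meeting_subset 𝒞 _)

lemma norm_ray_sub (hx : IsPole 𝒞 E Q x r) (ht : 0 ≤ t) : ‖radialProj x t Q.center - x‖ = t :=
  norm_radialProj_sub ht hx.center_ne

lemma ray_mem_unit (h : IsWhitney 𝒞 E) (hQ : Q ∈ 𝒞) (hx : IsPole 𝒞 E Q x r) (ht : 0 ≤ t)
    (htQ : t ≤ ‖Q.center - x‖) : radialProj x t Q.center ∈ (DyadicCube.unit n).toSet :=
  (DyadicCube.unit n).convex_toSet.add_smul_sub_mem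
    (h.mem_unit_of_norm_sub_le hx.mem (by simp)) (h.center_mem_unit hQ)
    ⟨by positivity, div_le_one_of_le₀ htQ (norm_nonneg _)⟩

lemma shortWalk_along_ray (h : IsWhitney 𝒞 E) (hQ : Q ∈ 𝒞) (hx : IsPole 𝒞 E Q x r)
    (hrt : r ≤ t₂) (ht : t₂ ≤ t₁) (htQ : t₁ ≤ ‖Q.center - x‖) (hratio : t₁ ≤ 32 * t₂)
    (hQ₁ : Q₁ ∈ 𝒞) (ht₁ : radialProj x t₁ Q.center ∈ closure Q₁.toSet)
    (hQ₂ : Q₂ ∈ 𝒞) (ht₂ : radialProj x t₂ Q.center ∈ closure Q₂.toSet) :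
    ShortWalk 𝒞 (walkBound n) Q₁ Q₂ := by
  have hr := hx.pos
  let G := (radialProj x · Q.center) '' Set.Icc t₂ t₁
  have hscale : meeting 𝒞 G ⊆ nearScale 512 (t₁ / 256) x := by
    rintro R ⟨hR, _, hyR, t, ⟨ht₂t, htt₁⟩, rfl⟩
    have hnorm := hx.norm_ray_sub (t := t) (by linarith)
    exact hx.mem_nearScale h hR hyR (by linarith) (by linarith [hx.norm_sub_le])
      (by linarith) (by linarith)
  obtain ⟨R, ⟨-, rfl⟩, hwalk⟩ := h.exists_shortWalk (G := G) (T := {Q₂})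
    (isPreconnected_Icc.image _ (continuous_radialProj_radius x Q.center).continuousOn)
    (by rintro _ ⟨t, ⟨ht₂t, htt₁⟩, rfl⟩
        exact hx.ray_mem_unit h hQ (by linarith) (by linarith))
    (a := t₁ / 256) (by linarith) (Set.sdiff_subset.trans hscale)
    ⟨hQ₁, _, ht₁, t₁, ⟨ht, le_rfl⟩, rfl⟩ ⟨hQ₂, _, ht₂, t₂, ⟨le_rfl, ht⟩, rfl⟩ rfl
  exact hwalk

lemma halfStep_along_ray (h : IsWhitney 𝒞 E) (hQ : Q ∈ 𝒞) (hx : IsPole 𝒞 E Q x r)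
    (hrt : 32 * r ≤ t) (htQ : t ≤ ‖Q.center - x‖) (hQ₁ : Q₁ ∈ 𝒞)
    (ht₁ : radialProj x t Q.center ∈ closure Q₁.toSet) (hQ₂ : Q₂ ∈ 𝒞)
    (ht₂ : radialProj x (t / 32) Q.center ∈ closure Q₂.toSet) :
    HalfStep 𝒞 (walkBound n) Q₁ Q₂ := by
  have hr := hx.pos
  refine ⟨hx.shortWalk_along_ray h hQ (by linarith) (by linarith) htQ (by linarith)
    hQ₁ ht₁ hQ₂ ht₂, ?_⟩
  have hnorm := hx.norm_ray_sub (t := t) (by linarith)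
  have hnorm' := hx.norm_ray_sub (t := t / 32) (by linarith)
  have hlower := hx.norm_le_eight_mul_side h hQ₁ ht₁ (by linarith) (by linarith [hx.norm_sub_le])
  have hupper := hx.side_le_two_mul_norm h hQ₂ ht₂ (by linarith)
  linarith

lemma exists_descent_along_ray (h : IsWhitney 𝒞 E) (hQ : Q ∈ 𝒞) (hx : IsPole 𝒞 E Q x r) (j : ℕ)
    (hrt : r ≤ t) (htQ : t ≤ ‖Q.center - x‖) (htj : t ≤ 32 ^ (j + 1) * r) (hQ₁ : Q₁ ∈ 𝒞)
    (ht : radialProj x t Q.center ∈ closure Q₁.toSet) :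
    ∃ Q₂ ∈ 𝒞, Relation.ReflTransGen (HalfStep 𝒞 (walkBound n)) Q₁ Q₂ ∧
      ∃ Q₃ ∈ 𝒞, radialProj x r Q.center ∈ closure Q₃.toSet ∧
        ShortWalk 𝒞 (walkBound n) Q₂ Q₃ := by
  have hr := hx.pos
  induction j generalizing t Q₁ with
  | zero =>
    obtain ⟨Q₃, hQ₃, hrQ₃⟩ := h.exists_mem _ (hx.ray_mem_unit h hQ hr.le (hrt.trans htQ))
    exact ⟨Q₁, hQ₁, Relation.ReflTransGen.refl, Q₃, hQ₃, subset_closure hrQ₃,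
      hx.shortWalk_along_ray h hQ le_rfl hrt htQ (by simpa using htj) hQ₁ ht hQ₃
        (subset_closure hrQ₃)⟩
  | succ j ih =>
    rcases le_or_gt t (32 ^ (j + 1) * r) with hle | hgt
    · exact ih hrt htQ hle hQ₁ ht
    have h32 : 32 * r ≤ t := by
      have : (32 : ℝ) ≤ 32 ^ (j + 1) := le_self_pow₀ (by norm_num) (by omega)
      nlinarith
    obtain ⟨Q', hQ', htQ'⟩ := h.exists_mem _
      (hx.ray_mem_unit h hQ (t := t / 32) (by linarith) (by linarith))
    obtain ⟨Q₂, hQ₂, hsteps, hQ₃⟩ := ih (t := t / 32) (by linarith) (by linarith)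
      (by rw [pow_succ] at htj; linarith) hQ' (subset_closure htQ')
    exact ⟨Q₂, hQ₂, hsteps.head
      (hx.halfStep_along_ray h hQ h32 htQ hQ₁ ht hQ' (subset_closure htQ')), hQ₃⟩

lemma exists_decayPath_to_sphere (h : IsWhitney 𝒞 E) (hQ : Q ∈ 𝒞) (hx : IsPole 𝒞 E Q x r) :
    ∃ Q' ∈ meeting 𝒞 (radialProj x r '' closure Q.toSet),
      DecayPath 𝒞 (decayConst n * decayConst n) (decayRate n) Q Q' := by
  have hr := hx.pos
  obtain ⟨j, hj⟩ := pow_unbounded_of_one_lt (‖Q.center - x‖ / r) (show (1 : ℝ) < 32 by norm_num)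
  have hj' : ‖Q.center - x‖ ≤ 32 ^ (j + 1) * r :=
    (div_le_iff₀ hr).1 (hj.le.trans (pow_le_pow_right₀ (by norm_num) (Nat.le_succ j)))
  obtain ⟨Q₁, hQ₁, hsteps, Q', hQ', hmem, hwalk⟩ := hx.exists_descent_along_ray h hQ j
    (by linarith [hx.le_side, hx.side_le_norm_sub]) le_rfl hj' hQ
    (by rw [radialProj_norm_sub hx.center_ne]; exact subset_closure Q.center_mem)
  exact ⟨Q', ⟨hQ', _, hmem, radialProj_center_mem x r Q⟩,
    (h.decayPath_of_halfSteps hQ hsteps).trans (decayRate_pos n).le (one_le_decayConst n)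
      (one_le_decayConst n) (h.decayPath_of_shortWalk hQ₁ hwalk)⟩

lemma mem_and_decayPath_of_mem_sphereComponent (h : IsWhitney 𝒞 E) (hQ : Q ∈ 𝒞)
    (hx : IsPole 𝒞 E Q x r) (hQ' : Q' ∈ sphereComponent 𝒞 x r Q) :
    Q' ∈ 𝒞 ∧ DecayPath 𝒞 (decayConst n ^ 3) (decayRate n) Q Q' := by
  obtain ⟨Q₁, hQ₁, hreach⟩ := hQ'
  obtain ⟨Q₂, hQ₂, hpath⟩ := hx.exists_decayPath_to_sphere h hQ
  have hQ₂sphere := meeting_mono hx.image_radialProj_subset_sphere hQ₂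
  have hreach' := (hx.reachable_of_neighbor h hQ hx (.refl Q) hQ₂ hQ₁).trans hreach
  obtain ⟨p⟩ := hreach'
  have hC := one_le_decayConst n
  rw [pow_succ, sq]
  exact ⟨(mem_of_mem_support hQ₂sphere p p.end_mem_support).1,
    hpath.trans (decayRate_pos n).le (one_le_mul_of_one_le_of_one_le hC hC) hC
      (h.decayPath_of_shortWalk hQ₂.1 (hx.shortWalk_of_reachable h hQ₂sphere ⟨p⟩))⟩

end IsPole

namespace IsWhitney

variable {𝒞 : Set (DyadicCube n)} {E : Finset (Fin n → ℝ)} {Q Q' : DyadicCube n}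
  {x : Fin n → ℝ}

lemma nearPoints_subset (h : IsWhitney 𝒞 E) (hQ : Q ∈ interstitial 𝒞 E) (hQ' : Q' ∈ 𝒞)
    (hnbr : Q.Neighbor Q') : nearPoints E Q ⊆ nearPoints E Q' := by
  intro e he
  rw [nearPoints, Finset.mem_filter] at he ⊢
  refine ⟨he.1, ?_⟩
  have hpos := Q.side_pos
  obtain ⟨x, hx, hxQ⟩ := h.exists_near Q hQ.1
  have hex := hQ.2.2 e he.1 x hx he.2 (by linarith)
  have hcenter := hnbr.norm_center_sub_le
  have hside := h.balanced Q' hQ' Q hQ.1 hnbr.symm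
  linarith [norm_sub_le_norm_sub_add_norm_sub e x Q'.center,
    norm_sub_le_norm_sub_add_norm_sub x Q.center Q'.center]

lemma nearPoints_eq (h : IsWhitney 𝒞 E) (hQ : Q ∈ interstitial 𝒞 E)
    (hQ' : Q' ∈ interstitial 𝒞 E) (hnbr : Q.Neighbor Q') : nearPoints E Q = nearPoints E Q' :=
  (h.nearPoints_subset hQ hQ'.1 hnbr).antisymm (h.nearPoints_subset hQ' hQ.1 hnbr.symm)

lemma nearPoints_nonempty (h : IsWhitney 𝒞 E) (hQ : Q ∈ 𝒞) : (nearPoints E Q).Nonempty := by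
  obtain ⟨x, hx, hxQ⟩ := h.exists_near Q hQ
  exact ⟨x, Finset.mem_filter.2 ⟨hx, by linarith [Q.side_pos]⟩⟩

lemma isPole_of_mem_nearPoints (h : IsWhitney 𝒞 E) (hQ : Q ∈ interstitial 𝒞 E)
    (hx : x ∈ nearPoints E Q) {R : DyadicCube n} (hR : R ∈ 𝒞) (hxR : x ∈ R.toSet) :
    IsPole 𝒞 E Q x (max (2 * Metric.diam (nearPoints E Q : Set (Fin n → ℝ))) (4 * R.side)) := by
  have hpos := Q.side_pos
  have hRpos := R.side_pos
  have hmem := Finset.mem_filter.1 hx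
  have hdiam : Metric.diam (nearPoints E Q : Set (Fin n → ℝ)) ≤ Q.side / 32 := by
    refine Metric.diam_le_of_forall_dist_le (by positivity) fun e he e' he' => ?_
    have he := Finset.mem_filter.1 (Finset.mem_coe.1 he)
    have he' := Finset.mem_filter.1 (Finset.mem_coe.1 he')
    exact (dist_eq_norm e e').trans_le (hQ.2.2 e he.1 e' he'.1 he.2 he'.2).le
  have hclose : ‖x - Q.center‖ ≤ 4 * Q.side := by
    obtain ⟨y, hy, hyQ⟩ := h.exists_near Q hQ.1
    have hxy := hQ.2.2 x hmem.1 y hy hmem.2 (by linarith)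
    linarith [norm_sub_le_norm_sub_add_norm_sub x y Q.center]
  have hRQ : 50 * R.side ≤ Q.side := by
    obtain ⟨R', hR', hxR', hsmall⟩ := hQ.2.1 x hmem.1 hclose
    linarith [h.balanced R' hR' R hR ⟨x, subset_closure hxR', subset_closure hxR⟩]
  have hfar : Q.side ≤ ‖Q.center - x‖ := by
    have hside := h.side_lt R hR Q hQ.1
    have hcenter := DyadicCube.norm_sub_center_le_of_mem hxR
    rw [norm_sub_rev R.center] at hside
    linarith [norm_sub_le_norm_sub_add_norm_sub Q.center x R.center]
  refine ⟨hmem.1, lt_max_of_lt_right (by positivity), max_le (by linarith) (by linarith),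
    by rwa [norm_sub_rev], hfar, ⟨R, hR, hxR, le_max_right _ _⟩, fun e he heQ => ?_⟩
  rw [← dist_eq_norm]
  have := Metric.dist_le_diam_of_mem (nearPoints E Q).finite_toSet.isBounded
    (Finset.mem_coe.2 (Finset.mem_filter.2 ⟨he, heQ⟩)) (Finset.mem_coe.2 hx)
  exact le_max_of_le_left (by linarith)

lemma exists_pole (h : IsWhitney 𝒞 E) :
    ∃ (X : Finset (Fin n → ℝ) → Fin n → ℝ) (r : Finset (Fin n → ℝ) → ℝ),
      ∀ Q ∈ interstitial 𝒞 E, IsPole 𝒞 E Q (X (nearPoints E Q)) (r (nearPoints E Q)) := by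
  choose! R hR hxR using fun x (hx : x ∈ E) => h.exists_mem_of_mem hx
  choose! X hX using fun (H : Finset (Fin n → ℝ)) (hH : H.Nonempty) => hH
  refine ⟨X, fun H => max (2 * Metric.diam (H : Set (Fin n → ℝ))) (4 * (R (X H)).side),
    fun Q hQ => ?_⟩
  have hmem := hX _ (h.nearPoints_nonempty hQ.1)
  have hE := (Finset.mem_filter.1 hmem).1
  exact h.isPole_of_mem_nearPoints hQ hmem (hR _ hE) (hxR _ hE)

lemma exists_target (h : IsWhitney 𝒞 E) :
    ∃ τ : DyadicCube n → DyadicCube n,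
      (∀ Q ∈ 𝒞, τ Q ∈ 𝒞 ∧ DecayPath 𝒞 (decayConst n ^ 3) (decayRate n) Q (τ Q)) ∧
      (∀ Q ∉ interstitial 𝒞 E, τ Q = Q) ∧
      ∀ Q ∈ interstitial 𝒞 E, ∀ Q' ∈ interstitial 𝒞 E, Q.Neighbor Q' → τ Q = τ Q' := by
  classical
  obtain ⟨X, r, hpole⟩ := h.exists_pole
  choose! pick hpick using fun (S : Set (DyadicCube n)) (hS : S.Nonempty) => hS
  let component (Q : DyadicCube n) : Set (DyadicCube n) :=
    sphereComponent 𝒞 (X (nearPoints E Q)) (r (nearPoints E Q)) Q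
  refine ⟨fun Q => if Q ∈ interstitial 𝒞 E then pick (component Q) else Q,
    fun Q hQ => ?_, fun Q hQ => if_neg hQ, fun Q hQ Q' hQ' hnbr => ?_⟩
  · beta_reduce
    split_ifs with hQint
    · have hx := hpole Q hQint
      exact hx.mem_and_decayPath_of_mem_sphereComponent h hQ
        (hpick _ (hx.sphereComponent_nonempty h hQ))
    · exact ⟨hQ, DecayPath.refl (one_le_pow₀ (one_le_decayConst n)) Q⟩
  · have hx := hpole Q hQ
    have hx' := hpole Q' hQ'
    have hcomponent : component Q = component Q' := by
      simp only [component]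
      rw [← h.nearPoints_eq hQ hQ' hnbr] at hx' ⊢
      exact (hx.sphereComponent_subset h hQ.1 hQ'.1 hx' hnbr).antisymm
        (hx'.sphereComponent_subset h hQ'.1 hQ.1 hx hnbr.symm)
    simp only [if_pos hQ, if_pos hQ', hcomponent]

end IsWhitney

/-! ### The assignment of keystone cubes -/

lemma encard_pairs_touching_le {α : Type*} {r : α → α → Prop} (hr : ∀ a b, r a b → r b a)
    {X : Set α} {D k : ℕ} (hdeg : ∀ a ∈ X, {b | r a b}.encard ≤ D) (hX : X.encard ≤ k) :
    {q : α × α | r q.1 q.2 ∧ (q.1 ∈ X ∨ q.2 ∈ X)}.encard ≤ (2 * (k * D) : ℕ) := by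
  obtain ⟨X, rfl⟩ := (Set.encard_le_coe_iff.1 hX).1.exists_finset_coe
  rw [Set.encard_coe_eq_coe_finsetCard, Nat.cast_le] at hX
  let P : Set (α × α) := ⋃ a ∈ X, Prod.mk a '' {b | r a b}
  have hP : P.encard ≤ (k * D : ℕ) :=
    calc P.encard ≤ ∑ a ∈ X, (Prod.mk a '' {b | r a b}).encard := Finset.set_encard_biUnion_le _ _
      _ ≤ X.card • (D : ℕ∞) := Finset.sum_le_card_nsmul _ _ _ fun a ha =>
          (Set.encard_image_le _ _).trans (hdeg a ha)
      _ ≤ (k * D : ℕ) := by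
          rw [nsmul_eq_mul]
          exact_mod_cast Nat.mul_le_mul_right D hX
  have hsub : {q : α × α | r q.1 q.2 ∧ (q.1 ∈ (X : Set α) ∨ q.2 ∈ (X : Set α))} ⊆
      P ∪ Prod.swap '' P := by
    rintro ⟨a, b⟩ ⟨hab, ha | hb⟩
    · exact Or.inl (Set.mem_biUnion ha ⟨b, hab, rfl⟩)
    · exact Or.inr ⟨(b, a), Set.mem_biUnion hb ⟨a, hr a b hab, rfl⟩, rfl⟩
  calc _ ≤ (P ∪ Prod.swap '' P).encard := Set.encard_le_encard hsub
    _ ≤ P.encard + (Prod.swap '' P).encard := Set.encard_union_le _ _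
    _ ≤ (k * D : ℕ) + (k * D : ℕ) := add_le_add hP ((Set.encard_image_le _ _).trans hP)
    _ = (2 * (k * D) : ℕ) := by rw [two_mul, Nat.cast_add]

/-- A bound for the number of pairs of neighbors with different keystone cubes, per point
of `E`. -/
def pairBound (n : ℕ) : ℕ := 2 * (exceptionalBound n * packingBound n 4)

namespace IsWhitney

variable {𝒞 : Set (DyadicCube n)} {E : Finset (Fin n → ℝ)} {Q : DyadicCube n}

lemma notMem_keystone_of_mem_interstitial (h : IsWhitney 𝒞 E) (hQ : Q ∈ interstitial 𝒞 E) :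
    Q ∉ keystone 𝒞 := by
  intro hkey
  have hpos := Q.side_pos
  obtain ⟨x, hx, hxQ⟩ := h.exists_near Q hQ.1
  obtain ⟨R, hR, hxR, hsmall⟩ := hQ.2.1 x hx (by linarith)
  linarith [hkey.2 R hR ⟨x, hxR, DyadicCube.mem_dilate_of_norm_lt (by linarith)⟩, R.side_pos]

lemma encard_neighbors_not_interstitial_le (h : IsWhitney 𝒞 E) :
    {q : DyadicCube n × DyadicCube n | (q.1 ∈ 𝒞 ∧ q.2 ∈ 𝒞 ∧ q.1.Neighbor q.2) ∧
      (q.1 ∈ 𝒞 \ interstitial 𝒞 E ∨ q.2 ∈ 𝒞 \ interstitial 𝒞 E)}.encard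
      ≤ (pairBound n * E.card : ℕ) := by
  have hdeg (Q : DyadicCube n) (hQ : Q ∈ 𝒞 \ interstitial 𝒞 E) :
      {Q' | Q ∈ 𝒞 ∧ Q' ∈ 𝒞 ∧ Q.Neighbor Q'}.encard ≤ packingBound n 4 :=
    (Set.encard_le_encard fun _ hQ' => hQ'.2).trans (h.encard_neighbors_le hQ.1)
  convert encard_pairs_touching_le (r := fun Q Q' => Q ∈ 𝒞 ∧ Q' ∈ 𝒞 ∧ Q.Neighbor Q')
    (fun _ _ hnbr => ⟨hnbr.2.1, hnbr.1, hnbr.2.2.symm⟩) hdeg h.encard_diff_interstitial_le using 2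
  rw [pairBound]
  ring

lemma exists_assignment (h : IsWhitney 𝒞 E) : ∃ κ : DyadicCube n → DyadicCube n,
    (∀ Q ∈ 𝒞, κ Q ∈ keystone 𝒞 ∧ DecayPath 𝒞 (decayConst n ^ 4) (decayRate n) Q (κ Q)) ∧
    {q : DyadicCube n × DyadicCube n | (q.1 ∈ 𝒞 ∧ q.2 ∈ 𝒞 ∧ q.1.Neighbor q.2) ∧
      κ q.1 ≠ κ q.2}.encard ≤ (pairBound n * E.card : ℕ) ∧
    ∀ Q ∈ keystone 𝒞, κ Q = Q := by
  obtain ⟨τ, hτ, hτ_fix, hτ_nbr⟩ := h.exists_target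
  choose! g hgkey hgsteps hgfix using fun Q hQ => h.exists_keystone (Q := Q) hQ
  have hC := one_le_decayConst n
  refine ⟨g ∘ τ, fun Q hQ => ?_, ?_, fun Q hQ => ?_⟩
  · obtain ⟨hτQ, hpath⟩ := hτ Q hQ
    exact ⟨hgkey _ hτQ, hpath.trans (decayRate_pos n).le (one_le_pow₀ hC) hC
      (h.decayPath_of_halfSteps hτQ (hgsteps _ hτQ))⟩
  · refine (Set.encard_le_encard ?_).trans h.encard_neighbors_not_interstitial_le
    rintro ⟨Q, Q'⟩ ⟨⟨hQ, hQ', hnbr⟩, hne⟩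
    refine ⟨⟨hQ, hQ', hnbr⟩, ?_⟩
    by_contra! hint
    simp only [Set.mem_sdiff, hQ, hQ', true_and, not_not] at hint
    exact hne (congrArg g (hτ_nbr Q hint.1 Q' hint.2 hnbr))
  · have hnot : Q ∉ interstitial 𝒞 E := fun hint => h.notMem_keystone_of_mem_interstitial hint hQ
    rw [Function.comp_apply, hτ_fix Q hnot, hgfix Q hQ.1 hQ]

end IsWhitney

/-- Conditions (K1), (K2), (K3) for the collection `𝒞`, with constants `C` and `c` and with `N` the
number of points: every `Q` in `𝒞` has a sequence `S Q 1, …, S Q (L Q)` that ends in a keystone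
cube. -/
def HasKeystoneSequences (C c : ℝ) (𝒞 : Set (DyadicCube n)) (N : ℕ) : Prop :=
  ∃ (L : 𝒞 → ℕ) (S : 𝒞 → ℕ → 𝒞),
    (∀ Q : 𝒞, 1 ≤ L Q ∧ S Q 1 = Q ∧ (S Q (L Q)).1 ∈ keystone 𝒞 ∧
      (∀ l, 1 ≤ l → l < L Q → (S Q l).1.Neighbor (S Q (l + 1)).1) ∧
      (∀ l k, 1 ≤ l → l ≤ k → k ≤ L Q →
        (S Q k).1.side ≤ C * (1 - c) ^ (k - l) * (S Q l).1.side)) ∧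
    (({q : 𝒞 × 𝒞 | q.1.1.Neighbor q.2.1 ∧ S q.1 (L q.1) ≠ S q.2 (L q.2)}.ncard : ℝ) ≤
      C * (N : ℝ)) ∧
    (∀ Q : 𝒞, Q.1 ∈ keystone 𝒞 → S Q (L Q) = Q)

/-- The constant `C` of the theorem. -/
def keystoneConst (n : ℕ) : ℝ := decayConst n ^ 4 + pairBound n

lemma keystoneConst_pos (n : ℕ) : 0 < keystoneConst n :=
  add_pos_of_pos_of_nonneg (pow_pos (zero_lt_one.trans_le (one_le_decayConst n)) 4)
    (Nat.cast_nonneg _)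

lemma IsWhitney.hasKeystoneSequences {𝒞 : Set (DyadicCube n)} {E : Finset (Fin n → ℝ)}
    (h : IsWhitney 𝒞 E) :
    HasKeystoneSequences (keystoneConst n) (1 - decayRate n) 𝒞 E.card := by
  obtain ⟨κ, hκ, hpairs, hκ_fix⟩ := h.exists_assignment
  choose p hp using fun Q : 𝒞 => (hκ Q Q.2).2
  let S (Q : 𝒞) (i : ℕ) : 𝒞 :=
    ⟨(p Q).getVert (i - 1), mem_of_mem_support Q.2 (p Q) ((p Q).getVert_mem_support _)⟩
  have hlast (Q : 𝒞) : (S Q ((p Q).length + 1)).1 = κ Q := (p Q).getVert_length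
  refine ⟨fun Q => (p Q).length + 1, S, fun Q => ⟨Nat.le_add_left 1 _, ?_, ?_, ?_, ?_⟩, ?_, ?_⟩
  · exact Subtype.ext (p Q).getVert_zero
  · rw [hlast]
    exact (hκ Q Q.2).1
  · intro l hl _
    obtain ⟨i, rfl⟩ := Nat.exists_eq_add_of_le' hl
    exact neighbor_getVert_succ (p Q) i
  · intro l k hl hlk hk
    have hdecay := (hp Q).mono (decayRate_pos n).le
      (le_add_of_nonneg_right (Nat.cast_nonneg (pairBound n))) (l - 1) (k - 1) (by omega)
      (Nat.sub_le_iff_le_add.2 hk)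
    rwa [show k - 1 - (l - 1) = k - l by omega, ← sub_sub_cancel 1 (decayRate n)] at hdecay
  · have hinj : Function.Injective (Prod.map Subtype.val Subtype.val : 𝒞 × 𝒞 → _) :=
      Subtype.val_injective.prodMap Subtype.val_injective
    have hcard : {q : 𝒞 × 𝒞 | q.1.1.Neighbor q.2.1 ∧
        S q.1 ((p q.1).length + 1) ≠ S q.2 ((p q.2).length + 1)}.encard ≤
        (pairBound n * E.card : ℕ) := by
      refine (Set.encard_le_encard_of_injOn ?_ hinj.injOn).trans hpairs
      rintro ⟨Q, Q'⟩ ⟨hnbr, hne⟩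
      exact ⟨⟨Q.2, Q'.2, hnbr⟩, fun heq => hne (Subtype.ext (by rw [hlast, hlast]; exact heq))⟩
    calc _ ≤ ((pairBound n * E.card : ℕ) : ℝ) :=
          Nat.cast_le.2 (Set.encard_le_coe_iff_finite_ncard_le.1 hcard).2
      _ = pairBound n * (E.card : ℝ) := Nat.cast_mul _ _
      _ ≤ keystoneConst n * (E.card : ℝ) := by
          have := one_le_decayConst n
          gcongr
          exact le_add_of_nonneg_left (by positivity)
  · intro Q hQ
    exact Subtype.ext ((hlast Q).trans (hκ_fix Q hQ))

/-! ### Jets and the Sobolev seminorm -/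

section Jets

variable {m : ℕ} {p : ℝ} {c : ℝ} {x : Fin n → ℝ} {α β : Fin n → ℕ} {F g : (Fin n → ℝ) → ℝ}
  {E E' : Set (Fin n → ℝ)} {P : MvPolynomial (Fin n) ℝ}

lemma pd_const_smul (i : Fin n) (c : ℝ) (F : (Fin n → ℝ) → ℝ) : pd i (c • F) = c • pd i F := by
  funext x
  simp only [pd, fderiv_const_smul_field, Pi.smul_apply, smul_apply]

lemma pderivs_const_smul (α : Fin n → ℕ) (c : ℝ) (F : (Fin n → ℝ) → ℝ) :
    pderivs α (c • F) = c • pderivs α F := by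
  have hiter (i : Fin n) : Function.Commute (pd i)^[α i] (c • ·) :=
    Function.Commute.iterate_left (pd_const_smul i c) (α i)
  unfold pderivs
  induction List.finRange n with
  | nil => rfl
  | cons i l ih => rw [List.foldr_cons, List.foldr_cons, ih]; exact hiter i _

lemma jet_const_smul (m : ℕ) (c : ℝ) (F : (Fin n → ℝ) → ℝ) (y : Fin n → ℝ) :
    jet m (c • F) y = c • jet m F y := by
  simp only [jet, Finset.smul_sum, pderivs_const_smul, Pi.smul_apply, smul_eq_mul, mul_div_assoc,
    MvPolynomial.C_mul, MvPolynomial.smul_eq_C_mul, mul_assoc]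

lemma HasWeakDeriv.const_smul (h : HasWeakDeriv α F g) (c : ℝ) :
    HasWeakDeriv α (c • F) (c • g) := by
  obtain ⟨hF, hg, hFg⟩ := h
  refine ⟨hF.smul c, hg.smul c, fun θ hθ hsupp => ?_⟩
  simp only [Pi.smul_apply, smul_eq_mul, mul_assoc]
  rw [integral_const_mul, integral_const_mul, hFg θ hθ hsupp, mul_left_comm]

lemma sobolevSeminorm_const_smul_le (m : ℕ) (p : ℝ) (hc : |c| ≤ 1) (F : (Fin n → ℝ) → ℝ) :
    sobolevSeminorm m p (c • F) ≤ sobolevSeminorm m p F := by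
  have hc' : ‖c‖ₑ ≤ 1 := by
    rw [← ofReal_norm, Real.norm_eq_abs]
    exact ENNReal.ofReal_le_one.2 hc
  refine iSup₂_mono fun α _ => le_iInf₂ fun g hg => iInf₂_le_of_le (c • g) (hg.const_smul c) ?_
  exact eLpNorm_const_smul_le.trans (mul_le_of_le_one_left' hc')

lemma smul_mem_sigma (hP : P ∈ sigma m p x E) (hc : |c| ≤ 1) : c • P ∈ sigma m p x E := by
  obtain ⟨φ, ⟨hsmooth, hfinite⟩, rfl, hzero, hnorm⟩ := hP
  have hle := sobolevSeminorm_const_smul_le m p hc φ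
  exact ⟨c • φ, ⟨hsmooth.const_smul c, hle.trans_lt hfinite⟩, jet_const_smul m c φ x,
    fun y hy => by rw [Pi.smul_apply, hzero y hy, smul_zero], hle.trans hnorm⟩

lemma sigma_anti (hE : E ⊆ E') : sigma m p x E' ⊆ sigma m p x E := by
  rintro P ⟨φ, hφ, hjet, hzero, hnorm⟩
  exact ⟨φ, hφ, hjet, fun y hy => hzero y (hE hy), hnorm⟩

lemma smul_sigma_subset_smul_sigma {a b : ℝ} (ha : 0 ≤ a) (hab : a ≤ b) (hE : E ⊆ E') :
    a • sigma m p x E' ⊆ b • sigma m p x E := by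
  rintro _ ⟨P, hP, rfl⟩
  refine ⟨(a / b) • P, smul_mem_sigma (sigma_anti hE hP) ?_, ?_⟩
  · rw [abs_of_nonneg (div_nonneg ha (ha.trans hab))]
    exact div_le_one_of_le₀ hab (ha.trans hab)
  · have hcancel : b * (a / b) = a :=
      mul_div_cancel_of_imp' fun hb => le_antisymm (hab.trans_eq hb) ha
    simp only [smul_smul, hcancel]

lemma partialSum_self (α : Fin n → ℕ) : partialSum α n = miOrder α := by
  simp [partialSum, miOrder]

lemma MultiIndexLT.miOrder_le (h : MultiIndexLT α β) : miOrder α ≤ miOrder β := by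
  obtain ⟨k, hk, heq, hlt⟩ := h
  rw [← partialSum_self α, ← partialSum_self β]
  rcases hk.lt_or_eq with hk | rfl
  · exact (heq n hk le_rfl).le
  · exact hlt.le

lemma ContainsBasis.mono (hp : (n : ℝ) ≤ p) {𝒜 : Finset (Fin n → ℕ)}
    (h𝒜 : 𝒜 ⊆ multiIndices n m) {ε δ δ' : ℝ} (hε : 0 ≤ ε) (hδ : 0 < δ) (hδδ' : δ ≤ δ')
    (hE : E ⊆ E') (h : ContainsBasis m p 𝒜 x ε δ' (sigma m p x E')) :
    ContainsBasis m p 𝒜 x ε δ (sigma m p x E) := by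
  have hrpow {s : ℝ} (hs : s ≤ 0) : ε * δ' ^ s ≤ ε * δ ^ s :=
    mul_le_mul_of_nonneg_left (Real.rpow_le_rpow_of_nonpos hδ hδδ' hs) hε
  obtain ⟨P, hP, hdual, hsmall⟩ := h
  refine ⟨P, fun α hα => ?_, hdual, fun α hα β hβ hlt =>
    (hsmall α hα β hβ hlt).trans (hrpow ?_)⟩
  · have hexp : (n : ℝ) / p + miOrder α - m ≤ 0 := by
      have hα' : (miOrder α : ℝ) + 1 ≤ m := by
        exact_mod_cast (Finset.mem_filter.1 (h𝒜 hα)).2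
      linarith [div_le_one_of_le₀ hp ((Nat.cast_nonneg n).trans hp)]
    exact smul_sigma_subset_smul_sigma
      (mul_nonneg hε (Real.rpow_nonneg (hδ.le.trans hδδ') _)) (hrpow hexp) hE (hP α hα)
  · exact sub_nonpos.2 (Nat.cast_le.2 hlt.miOrder_le)

end Jets

/-! ### The Calderón–Zygmund decomposition -/

section CalderonZygmund

variable {m : ℕ} {p : ℝ} {𝒜 : Finset (Fin n → ℕ)} {ε₀ : ℝ} {E : Finset (Fin n → ℝ)}
  {Q Q' : DyadicCube n}

lemma IsOK.mono (hp : (n : ℝ) ≤ p) (hε₀ : 0 ≤ ε₀) (hdilate : Q.dilate 3 ⊆ Q'.dilate 3)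
    (hside : Q.side ≤ Q'.side) (h : IsOK m p 𝒜 ε₀ E Q') : IsOK m p 𝒜 ε₀ E Q := by
  have hsub := Set.inter_subset_inter_right (E : Set (Fin n → ℝ)) hdilate
  rcases h with hcard | ⟨𝒜', h𝒜', hlt, hbasis⟩
  · exact Or.inl ((Set.ncard_le_ncard hsub (E.finite_toSet.inter_of_left _)).trans hcard)
  · exact Or.inr ⟨𝒜', h𝒜', hlt, fun x hx => (hbasis x (hsub hx)).mono hp h𝒜' hε₀
      (mul_pos (by norm_num) Q.side_pos) (by linarith) hsub⟩

lemma not_isOK_unit (hp : (n : ℝ) ≤ p) (hε₀ : 0 ≤ ε₀) (hcard : 2 ≤ E.card)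
    (hE : (E : Set (Fin n → ℝ)) ⊆ (DyadicCube.unit n).dilate (1 / 8))
    (hmin : ∀ 𝒜' ⊆ multiIndices n m, LabelLT 𝒜' 𝒜 →
      ∃ x ∈ E, ¬ ContainsBasis m p 𝒜' x ε₀ 1 (sigma m p x (E : Set (Fin n → ℝ)))) :
    ¬ IsOK m p 𝒜 ε₀ E (DyadicCube.unit n) := by
  have hunit := DyadicCube.side_unit n
  have hE3 : (E : Set (Fin n → ℝ)) ∩ (DyadicCube.unit n).dilate 3 = E :=
    Set.inter_eq_left.2 (hE.trans (DyadicCube.dilate_subset_dilate (by rw [hunit]; norm_num)))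
  rw [IsOK, hE3, hunit, Set.ncard_coe_finset]
  rintro (hle | ⟨𝒜', h𝒜', hlt, hbasis⟩)
  · omega
  · obtain ⟨x, hx, hnot⟩ := hmin 𝒜' h𝒜' hlt
    exact hnot ((hbasis x hx).mono hp h𝒜' hε₀ one_pos (by norm_num) subset_rfl)

lemma exists_ne_of_not_isOK (h : ¬ IsOK m p 𝒜 ε₀ E Q) : ∃ x ∈ E, ∃ y ∈ E, x ≠ y ∧
    ‖x - Q.center‖ ≤ 3 * Q.side / 2 ∧ ‖y - Q.center‖ ≤ 3 * Q.side / 2 := by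
  obtain ⟨x, hx, y, hy, hxy⟩ :=
    (Set.one_lt_ncard (E.finite_toSet.inter_of_left _)).1 (not_le.1 (not_or.1 h).1)
  exact ⟨x, hx.1, y, hy.1, hxy, DyadicCube.norm_sub_center_le_of_mem_dilate (by norm_num) hx.2,
    DyadicCube.norm_sub_center_le_of_mem_dilate (by norm_num) hy.2⟩

lemma infsep_pos_of_not_isOK (h : ¬ IsOK m p 𝒜 ε₀ E Q) :
    0 < (E : Set (Fin n → ℝ)).infsep := by
  obtain ⟨x, hx, y, hy, hxy, -⟩ := exists_ne_of_not_isOK h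
  exact E.infsep_pos_iff_nontrivial.2 ⟨x, hx, y, hy, hxy⟩

lemma infsep_le_of_not_isOK (h : ¬ IsOK m p 𝒜 ε₀ E Q) :
    (E : Set (Fin n → ℝ)).infsep ≤ 3 * Q.side := by
  obtain ⟨x, hx, y, hy, hxy, hxQ, hyQ⟩ := exists_ne_of_not_isOK h
  refine (Set.infsep_le_dist_of_mem hx hy hxy).trans ?_
  rw [← dist_eq_norm] at hxQ hyQ
  linarith [dist_triangle_right x y Q.center]

lemma exists_isOK_around (hinfsep : 0 < (E : Set (Fin n → ℝ)).infsep) (y : Fin n → ℝ) :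
    ∃ K : ℕ, IsOK m p 𝒜 ε₀ E (DyadicCube.around y (-K)) := by
  obtain ⟨K, hK⟩ := exists_pow_lt_of_lt_one (div_pos hinfsep three_pos) one_half_lt_one
  refine ⟨K, by_contra fun hnot => hK.not_ge ?_⟩
  rw [div_le_iff₀' three_pos]
  refine (infsep_le_of_not_isOK hnot).trans_eq ?_
  rw [DyadicCube.side, DyadicCube.around, zpow_neg, zpow_natCast, one_div, inv_pow]

lemma exists_mem_CZ (hn : 1 ≤ n) (hinfsep : 0 < (E : Set (Fin n → ℝ)).infsep)
    {y : Fin n → ℝ} (hy : y ∈ (DyadicCube.unit n).toSet) :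
    ∃ Q ∈ CZ m p 𝒜 ε₀ E, y ∈ Q.toSet := by
  classical
  have hex : ∃ K : ℕ, IsOK m p 𝒜 ε₀ E (DyadicCube.around y (-K)) := exists_isOK_around hinfsep y
  have hyQ := DyadicCube.mem_toSet_around y (-(Nat.find hex : ℤ))
  refine ⟨_, ⟨?_, Nat.find_spec hex, fun Q hQunit hssub hOK => ?_⟩, hyQ⟩
  · exact DyadicCube.toSet_subset_of_k_le (Q' := DyadicCube.unit n)
      (neg_nonpos.2 (Nat.cast_nonneg _)) hyQ hy
  · have hyQ' := hssub.1 hyQ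
    have hk : Q.k ≤ 0 :=
      DyadicCube.side_le_side_iff.1 (DyadicCube.side_le_of_toSet_subset hn hQunit)
    obtain ⟨K, hK⟩ := Int.exists_eq_neg_ofNat hk
    rw [DyadicCube.mem_toSet_iff_eq_around.1 hyQ', hK] at hOK
    have hle : Q.k ≤ -(Nat.find hex : ℤ) := by
      rw [hK]
      exact neg_le_neg (Nat.cast_le.2 (Nat.find_min' hex hOK))
    exact hssub.2 (DyadicCube.toSet_subset_of_k_le hle hyQ' hyQ)

lemma side_le_half_and_not_isOK_parent (hn : 1 ≤ n)
    (hunit : ¬ IsOK m p 𝒜 ε₀ E (DyadicCube.unit n)) (hQ : Q ∈ CZ m p 𝒜 ε₀ E) :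
    Q.side ≤ 1 / 2 ∧ ¬ IsOK m p 𝒜 ε₀ E Q.parent := by
  obtain ⟨hsub, hOK, hmax⟩ := hQ
  rcases DyadicCube.eq_unit_or_parent_subset hn hsub with rfl | ⟨hside, hparent⟩
  · exact absurd hOK hunit
  · exact ⟨hside, hmax _ hparent (Q.toSet_ssubset_parent hn)⟩

lemma finite_CZ (hn : 1 ≤ n) (hunit : ¬ IsOK m p 𝒜 ε₀ E (DyadicCube.unit n)) :
    (CZ m p 𝒜 ε₀ E).Finite := by
  set η := (E : Set (Fin n → ℝ)).infsep
  have hη : 0 < η := infsep_pos_of_not_isOK hunit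
  have hone : 6 / η * (η / 6) = 1 := by field_simp
  refine (Set.finite_of_encard_le_coe (encard_nearScale_le (K := 6 / η) (a := η / 6)
    (by positivity) (DyadicCube.unit n).center)).subset fun Q hQ => ?_
  obtain ⟨hside, hparent⟩ := side_le_half_and_not_isOK_parent hn hunit hQ
  have hlower := infsep_le_of_not_isOK hparent
  have hcenter := DyadicCube.norm_sub_center_le_of_mem (hQ.1 Q.center_mem)
  rw [Q.side_parent] at hlower
  rw [DyadicCube.side_unit] at hcenter
  exact ⟨by linarith, by linarith, by linarith⟩

lemma side_lt_of_not_isOK_parent (hp : (n : ℝ) ≤ p) (hε₀ : 0 ≤ ε₀)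
    (hparent : ¬ IsOK m p 𝒜 ε₀ E Q.parent) (hOK : IsOK m p 𝒜 ε₀ E Q') :
    Q'.side < 2 / 3 * ‖Q.center - Q'.center‖ + 7 / 3 * Q.side := by
  by_contra! hle
  have hdist := norm_sub_le_norm_sub_add_norm_sub Q.parent.center Q.center Q'.center
  have := Q.norm_parent_center_sub_le
  have hside := Q.side_parent
  refine hparent (hOK.mono hp hε₀ (DyadicCube.dilate_subset_dilate ?_) ?_)
  · linarith
  · linarith [norm_nonneg (Q.center - Q'.center), Q.side_pos]

lemma isWhitney_CZ (hn : 1 ≤ n) (hp : (n : ℝ) ≤ p) (hε₀ : 0 ≤ ε₀)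
    (hE : (E : Set (Fin n → ℝ)) ⊆ (DyadicCube.unit n).dilate (1 / 8))
    (hunit : ¬ IsOK m p 𝒜 ε₀ E (DyadicCube.unit n)) : IsWhitney (CZ m p 𝒜 ε₀ E) E where
  finite := finite_CZ hn hunit
  exists_mem _ := exists_mem_CZ hn (infsep_pos_of_not_isOK hunit)
  subset_unit _ hQ := hQ.1
  side_lt Q hQ Q' hQ' :=
    side_lt_of_not_isOK_parent hp hε₀ (side_le_half_and_not_isOK_parent hn hunit hQ).2 hQ'.2.1
  exists_near Q hQ := by
    obtain ⟨x, hx, -, -, -, hxQ, -⟩ :=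
      exists_ne_of_not_isOK (side_le_half_and_not_isOK_parent hn hunit hQ).2
    rw [Q.side_parent] at hxQ
    refine ⟨x, hx, ?_⟩
    linarith [norm_sub_le_norm_sub_add_norm_sub x Q.parent.center Q.center,
      Q.norm_parent_center_sub_le]
  side_le_half Q hQ := (side_le_half_and_not_isOK_parent hn hunit hQ).1
  norm_sub_le x hx := by
    have := DyadicCube.norm_sub_center_le_of_mem_dilate (by norm_num) (hE hx)
    rw [DyadicCube.side_unit] at this
    linarith

end CalderonZygmund

end SobolevExt

end

theorem mainTheorem6_general (n : ℕ) (hn : 1 ≤ n) :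
    ∃ C c : ℝ, 0 < C ∧ 0 < c ∧ c < 1 ∧
      ∀ (m : ℕ) (p : ℝ), (n : ℝ) ≤ p →
      ∀ (𝒜 : Finset (Fin n → ℕ)) (ε₀ : ℝ), 0 < ε₀ →
      ∀ (E : Finset (Fin n → ℝ)), 2 ≤ E.card →
      (E : Set (Fin n → ℝ)) ⊆ (DyadicCube.unit n).dilate (1 / 8) →
      (∀ 𝒜' : Finset (Fin n → ℕ), 𝒜' ⊆ multiIndices n m → LabelLT 𝒜' 𝒜 →
        ∃ x ∈ E, ¬ ContainsBasis m p 𝒜' x ε₀ 1 (sigma m p x (E : Set (Fin n → ℝ)))) →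
      (CZ m p 𝒜 ε₀ E).Finite ∧ HasKeystoneSequences C c (CZ m p 𝒜 ε₀ E) E.card := by
  refine ⟨keystoneConst n, 1 - decayRate n, keystoneConst_pos n, sub_pos.2 (decayRate_lt_one n),
    sub_lt_self 1 (decayRate_pos n), fun m p hp 𝒜 ε₀ hε₀ E hcard hE hmin => ?_⟩
  have hunit := not_isOK_unit hp hε₀.le hcard hE hmin
  have hCZ := isWhitney_CZ hn hp hε₀.le hE hunit
  exact ⟨hCZ.finite, hCZ.hasKeystoneSequences⟩

theorem mainTheorem6 (m n : ℕ) (hm : 1 ≤ m) (hn : 1 ≤ n) (p : ℝ) (hp : (n : ℝ) < p) :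
    ∃ C c : ℝ, 0 < C ∧ 0 < c ∧ c < 1 ∧
      ∀ (𝒜 : Finset (Fin n → ℕ)), 𝒜 ⊂ multiIndices n m →
      ∀ (ε₀ : ℝ), 0 < ε₀ →
      ∀ (E : Finset (Fin n → ℝ)), 2 ≤ E.card →
      (E : Set (Fin n → ℝ)) ⊆ (DyadicCube.unit n).dilate (1 / 8) →
      (∀ 𝒜' : Finset (Fin n → ℕ), 𝒜' ⊆ multiIndices n m → LabelLT 𝒜' 𝒜 →
        ∃ x ∈ E, ¬ ContainsBasis m p 𝒜' x ε₀ 1 (sigma m p x (E : Set (Fin n → ℝ)))) →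
      (CZ m p 𝒜 ε₀ E).Finite ∧
      ∃ (L : CZ m p 𝒜 ε₀ E → ℕ) (S : CZ m p 𝒜 ε₀ E → ℕ → CZ m p 𝒜 ε₀ E),
        -- (K1), for the sequence `S Q 1, …, S Q (L Q)`
        (∀ Q : CZ m p 𝒜 ε₀ E,
          1 ≤ L Q ∧ S Q 1 = Q ∧ (S Q (L Q)).1 ∈ keystone (CZ m p 𝒜 ε₀ E) ∧
          (∀ l, 1 ≤ l → l < L Q → (S Q l).1.Neighbor (S Q (l + 1)).1) ∧
          (∀ l k, 1 ≤ l → l ≤ k → k ≤ L Q →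
            (S Q k).1.side ≤ C * (1 - c) ^ (k - l) * (S Q l).1.side)) ∧
        -- (K2)
        (({q : CZ m p 𝒜 ε₀ E × CZ m p 𝒜 ε₀ E |
            q.1.1.Neighbor q.2.1 ∧ S q.1 (L q.1) ≠ S q.2 (L q.2)}.ncard : ℝ) ≤ C * (E.card : ℝ)) ∧
        -- (K3)
        (∀ Q : CZ m p 𝒜 ε₀ E, Q.1 ∈ keystone (CZ m p 𝒜 ε₀ E) → S Q (L Q) = Q) := by
  obtain ⟨C, c, hC, hc, hc1, h⟩ := mainTheorem6_general n hn
  exact ⟨C, c, hC, hc, hc1, fun 𝒜 _ => h m p hp.le 𝒜⟩
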